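/- Let $\mathbb H$ be an infinite-dimensional separable complex Hilbert space (inner product linear in the second slot) and $\mathbb K$ a strictly positive-definite trace-class operator on $\mathbb H$, with an orthonormal eigenbasis $\xi_1,\xi_2,\dots$, $\mathbb K\xi_j=k_j^2\xi_j$, $k_j>0$. Let $\mu$ be the centred Gaussian measure on $\mathbb H$ with covariance $\mathbb K$, i.e. $\int_{\mathbb H} e^{i\,\mathrm{Re}\langle\xi,x\rangle}\,d\mu(x)=e^{-\frac14\langle\xi,\mathbb K\xi\rangle}$ for all $\xi\in\mathbb H$. For a multi-index $I=(i_1,i_2,\dots)$ of nonnegative integers with finite sum let $z^I=\prod_j z_j^{i_j}$, where $z_j(x)=\langle\xi_j,x\rangle$. Let the Segal–Bargmann space $\mathcal HL^2(\mathbb H,\mu)\subset L^2(\mathbb H,\mu)$ be the space of all $f=\sum_I a_Iz^I$ with complex coefficients, the series converging in $L^2(\mathbb H,\mu)$. Let $\mathbb H_\mu=\mathbb K^{1/2}\mathbb H$ be the Cameron–Martin space with inner product $\langle\mathbb K^{-1/2}\xi,\mathbb K^{-1/2}\eta\rangle$, and let $\mathbb H_\mu^*$ be its dual Hilbert space; $\xi_j$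 is regarded as the element $\langle\xi_j,\cdot\rangle_{\mathbb H}$, restricted to $\mathbb H_\mu$, of $\mathbb H_\mu^*$. For a Hilbert space $H$ let $H^{\vee n}$ be the space of symmetric tensors in the algebraic tensor power $H^{\otimes n}$, let $T^\vee(H)=\bigoplus_{n\ge0}H^{\vee n}$ be the (algebraic) symmetric tensor algebra, and let the symmetric Fock space $F(H)$ be its completion for the inner product $\sum_n n!\,\langle\cdot,\cdot\rangle_{H^{\otimes n}}$. The product $\vee$ on $T^\vee(H)$ is bilinear with $a\vee b=P_+(a\otimes b)$ for homogeneous $a,b$, where $P_+(\eta_1\otimes\cdots\otimes\eta_n)=\frac1{n!}\sum_{\sigma\in S_n}\eta_{\sigma(1)}\otimes\cdots\otimes\eta_{\sigma(n)}$; $\xi^{\vee I}$ denotes the $\vee$-product in which each $\xi_j$ occurs $i_j$ times. **Proposition.** The assignment $\theta(\xi^{\vee I})=z^I$ extends, uniquely as a bounded linear map, to an isometric isomorphism $\theta\colon F(\mathbb H_\mu^*)\to\mathcal HL^2(\mathbb H,\mu)$. It intertwines $\vee$ with pointwise multiplication: for all $a,b\in T^\vee(\mathbb H_\mu^*)$,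 $$\theta(a\vee b)=\theta(a)\,\theta(b)\qquad\mu\text{-almost everywhere.}$$ Moreover $\theta$ maps the linear span of the $\xi^{\vee I}$ onto the space of polynomials $\sum_I c_Iz^I$ (finite sums). -/

import Mathlib

open MeasureTheory ProbabilityTheory TopologicalSpace
open scoped TensorProduct ComplexOrder InnerProductSpace

noncomputable section

namespace SegalFock

/-! ### Algebraic tensor powers of an inner product space -/

section Tensor

variable (E : Type*) [NormedAddCommGroup E] [InnerProductSpace ℂ E]

/-- The isomorphism `E^{⊗(n+1)} ≃ E ⊗ E^{⊗n}`, `x₀ ⊗ ⋯ ⊗ xₙ ↦ x₀ ⊗ (x₁ ⊗ ⋯ ⊗ xₙ)`. -/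
def tensorSuccEquiv (n : ℕ) : (⨂[ℂ]^(n + 1)) E ≃ₗ[ℂ] E ⊗[ℂ] (⨂[ℂ]^n) E :=
  (PiTensorProduct.reindex ℂ (fun _ : Fin (n + 1) => E)
      ((finCongr (Nat.add_comm n 1)).trans (finSumFinEquiv (m := 1) (n := n)).symm)).trans
    ((PiTensorProduct.tmulEquiv ℂ E).symm.trans
      (LinearEquiv.rTensor _ (PiTensorProduct.subsingletonEquiv (0 : Fin 1))))

theorem tensorSuccEquiv_tprod (n : ℕ) (x : Fin (n + 1) → E) :
    tensorSuccEquiv E n (PiTensorProduct.tprod ℂ x) =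
      x 0 ⊗ₜ[ℂ] PiTensorProduct.tprod ℂ (fun i : Fin n => x i.succ) := by
  simp only [tensorSuccEquiv, LinearEquiv.trans_apply]
  rw [PiTensorProduct.reindex_tprod]
  erw [PiTensorProduct.tmulEquiv_symm_apply]
  rw [LinearEquiv.rTensor_tmul, PiTensorProduct.subsingletonEquiv_apply_tprod]
  congr 2
  funext i
  congr 1
  ext
  simp [finSumFinEquiv]

/-- Transport of an inner product along an injective linear map into an inner product space. -/
@[reducible] def coreOfInjective {V W : Type*} [AddCommGroup V] [Module ℂ V]
    [NormedAddCommGroup W] [InnerProductSpace ℂ W] (f : V →ₗ[ℂ] W)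
    (hf : Function.Injective f) : InnerProductSpace.Core ℂ V where
  inner x y := inner ℂ (f x) (f y)
  conj_inner_symm x y := inner_conj_symm _ _
  re_inner_nonneg x := inner_self_nonneg
  add_left x y z := by rw [map_add, inner_add_left]
  smul_left x y r := by rw [map_smul, inner_smul_left]
  definite x h := hf (by rw [map_zero]; exact inner_self_eq_zero.mp h)

variable {E} in
/-- The inner product pulled back along an injective linear map `f : U → E ⊗ V`, where `c` is an
inner product on `V` and `E ⊗ V` has the inner product `⟨x ⊗ v, y ⊗ w⟩ = ⟨x, y⟩ c(v, w)`. -/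
@[reducible] def coreStep {U V : Type*} [AddCommGroup U] [Module ℂ U] [AddCommGroup V]
    [Module ℂ V] (c : InnerProductSpace.Core ℂ V) (f : U →ₗ[ℂ] E ⊗[ℂ] V)
    (hf : Function.Injective f) : InnerProductSpace.Core ℂ U :=
  letI : NormedAddCommGroup V := c.toNormedAddCommGroup
  letI : InnerProductSpace ℂ V := InnerProductSpace.ofCore c.toCore
  coreOfInjective (W := E ⊗[ℂ] V) f hf

theorem coreStep_inner {U V : Type*} [AddCommGroup U] [Module ℂ U] [AddCommGroup V]
    [Module ℂ V] (c : InnerProductSpace.Core ℂ V) (f : U →ₗ[ℂ] E ⊗[ℂ] V)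
    (hf : Function.Injective f) (s t : U) (x y : E) (v w : V)
    (hs : f s = x ⊗ₜ[ℂ] v) (ht : f t = y ⊗ₜ[ℂ] w) :
    (coreStep c f hf).inner s t = inner ℂ x y * c.inner v w := by
  let : NormedAddCommGroup V := c.toNormedAddCommGroup
  let : InnerProductSpace ℂ V := InnerProductSpace.ofCore c.toCore
  change inner ℂ (f s) (f t) = _
  rw [hs, ht]
  exact TensorProduct.inner_tmul ℂ x y v w

/-- The inner product of `E^{⊗n}`, by recursion on `n`; by `tensorInner_tprod` below it is
characterised by `⟨x₁ ⊗ ⋯ ⊗ xₙ, y₁ ⊗ ⋯ ⊗ yₙ⟩ = ∏ᵢ ⟨xᵢ, yᵢ⟩`. -/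
@[reducible] def tensorCore : (n : ℕ) → InnerProductSpace.Core ℂ ((⨂[ℂ]^n) E)
  | 0 => coreOfInjective (W := ℂ)
      (PiTensorProduct.isEmptyEquiv (R := ℂ) (s := fun _ : Fin 0 => E) (Fin 0)).toLinearMap
      (LinearEquiv.injective _)
  | n + 1 => coreStep (tensorCore n) (tensorSuccEquiv E n).toLinearMap (LinearEquiv.injective _)

/-- The inner product of the algebraic tensor power `E^{⊗n}`. -/
def tensorInner {n : ℕ} (s t : (⨂[ℂ]^n) E) : ℂ := (tensorCore E n).inner s t

theorem tensorInner_tprod (n : ℕ) (x y : Fin n → E) :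
    tensorInner E (PiTensorProduct.tprod ℂ x) (PiTensorProduct.tprod ℂ y) =
      ∏ i, inner ℂ (x i) (y i) := by
  induction n with
  | zero =>
    have h : ∀ z : Fin 0 → E, PiTensorProduct.isEmptyEquiv (R := ℂ) (Fin 0)
        (PiTensorProduct.tprod ℂ z) = 1 := fun z => PiTensorProduct.isEmptyEquiv_apply_tprod _ z
    change inner ℂ (PiTensorProduct.isEmptyEquiv (R := ℂ) (Fin 0) (PiTensorProduct.tprod ℂ x))
      (PiTensorProduct.isEmptyEquiv (R := ℂ) (Fin 0) (PiTensorProduct.tprod ℂ y)) = _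
    rw [h, h]
    simp
  | succ n ih =>
    rw [Fin.prod_univ_succ, ← ih]
    exact coreStep_inner E (tensorCore E n) _ _ _ _ _ _ _ _ (tensorSuccEquiv_tprod E n x)
      (tensorSuccEquiv_tprod E n y)

/-- Permutation of the tensor factors of `E^{⊗n}`. -/
def permute {n : ℕ} (σ : Equiv.Perm (Fin n)) : (⨂[ℂ]^n) E →ₗ[ℂ] (⨂[ℂ]^n) E :=
  (PiTensorProduct.reindex ℂ (fun _ : Fin n => E) σ).toLinearMap

theorem permute_tprod {n : ℕ} (σ : Equiv.Perm (Fin n)) (x : Fin n → E) :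
    permute E σ (PiTensorProduct.tprod ℂ x) =
      PiTensorProduct.tprod ℂ (fun i => x (σ.symm i)) :=
  PiTensorProduct.reindex_tprod _ _

theorem permute_permute {n : ℕ} (σ τ : Equiv.Perm (Fin n)) (t : (⨂[ℂ]^n) E) :
    permute E σ (permute E τ t) = permute E (σ * τ) t := by
  have h : permute E σ ∘ₗ permute E τ = permute E (σ * τ) := by
    apply PiTensorProduct.ext
    ext x
    simp only [LinearMap.compMultilinearMap_apply, LinearMap.comp_apply, permute_tprod]
    rfl
  exact LinearMap.congr_fun h t

/-- The subspace `E^{∨n}` of symmetric tensors of `E^{⊗n}`. -/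
def symTensor (n : ℕ) : Submodule ℂ ((⨂[ℂ]^n) E) where
  carrier := {t | ∀ σ : Equiv.Perm (Fin n), permute E σ t = t}
  add_mem' hs ht σ := by rw [map_add, hs σ, ht σ]
  zero_mem' σ := map_zero _
  smul_mem' c t ht σ := by rw [map_smul, ht σ]

/-- The symmetrisation `P₊(η₁ ⊗ ⋯ ⊗ ηₙ) = (1/n!) ∑_σ η_{σ(1)} ⊗ ⋯ ⊗ η_{σ(n)}`. -/
def symmetrize (n : ℕ) : (⨂[ℂ]^n) E →ₗ[ℂ] symTensor E n :=
  LinearMap.codRestrict (symTensor E n)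
    (((n.factorial : ℂ)⁻¹) • ∑ σ : Equiv.Perm (Fin n), permute E σ) (by
      intro t τ
      simp only [LinearMap.smul_apply, LinearMap.sum_apply, map_smul, map_sum, permute_permute]
      congr 1
      exact Fintype.sum_equiv (Equiv.mulLeft τ) _ _ (fun σ => rfl))

/-- The tensor product of a tensor of degree `n` and a tensor of degree `m`. -/
def tensorMul (n m : ℕ) : (⨂[ℂ]^n) E →ₗ[ℂ] (⨂[ℂ]^m) E →ₗ[ℂ] (⨂[ℂ]^(n + m)) E :=
  (TensorProduct.mk ℂ _ _).compr₂ (TensorPower.mulEquiv (R := ℂ) (M := E)).toLinearMap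

/-! ### The symmetric tensor algebra and the Fock space -/

/-- The symmetric tensor algebra `T^∨(E) = ⨁ₙ E^{∨n}` (an algebraic direct sum). -/
def SymTensorAlg : Type _ := DirectSum ℕ (fun n => symTensor E n)

instance : AddCommGroup (SymTensorAlg E) :=
  inferInstanceAs (AddCommGroup (DirectSum ℕ (fun n => symTensor E n)))

instance : Module ℂ (SymTensorAlg E) :=
  inferInstanceAs (Module ℂ (DirectSum ℕ (fun n => symTensor E n)))

/-- The inclusion of `E^{∨n}` into `T^∨(E)`. -/
def inclusion (n : ℕ) : symTensor E n →ₗ[ℂ] SymTensorAlg E :=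
  DirectSum.lof ℂ ℕ (fun n => symTensor E n) n

/-- The component of degree `n`. -/
def component (n : ℕ) : SymTensorAlg E →ₗ[ℂ] symTensor E n :=
  DirectSum.component ℂ ℕ (fun n => symTensor E n) n

/-- The symmetric tensor product `∨` on `T^∨(E)`: the bilinear map with
`a ∨ b = P₊(a ⊗ b)` for `a ∈ E^{∨n}` and `b ∈ E^{∨m}`. -/
def vee : SymTensorAlg E →ₗ[ℂ] SymTensorAlg E →ₗ[ℂ] SymTensorAlg E :=
  DirectSum.toModule ℂ ℕ _ fun n =>
    LinearMap.flip (DirectSum.toModule ℂ ℕ _ fun m =>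
      LinearMap.flip
        (((tensorMul E n m).compr₂ (inclusion E (n + m) ∘ₗ symmetrize E (n + m))).compl₁₂
          (symTensor E n).subtype (symTensor E m).subtype))

theorem vee_inclusion (n m : ℕ) (a : symTensor E n) (b : symTensor E m) :
    vee E (inclusion E n a) (inclusion E m b) =
      inclusion E (n + m) (symmetrize E (n + m) (tensorMul E n m a b)) := by
  have h1 := LinearMap.congr_fun (DirectSum.toModule_lof ℂ
    (φ := fun n => LinearMap.flip (DirectSum.toModule ℂ ℕ (symTensor E n →ₗ[ℂ] SymTensorAlg E)
      fun m => LinearMap.flip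
        (((tensorMul E n m).compr₂ (inclusion E (n + m) ∘ₗ symmetrize E (n + m))).compl₁₂
          (symTensor E n).subtype (symTensor E m).subtype))) n a) (inclusion E m b)
  have h2 := LinearMap.congr_fun (DirectSum.toModule_lof ℂ (N := symTensor E n →ₗ[ℂ] SymTensorAlg E)
    (φ := fun m => LinearMap.flip
        (((tensorMul E n m).compr₂ (inclusion E (n + m) ∘ₗ symmetrize E (n + m))).compl₁₂
          (symTensor E n).subtype (symTensor E m).subtype)) m b) a
  exact h1.trans h2

/-- `η₁ ∨ ⋯ ∨ ηₙ = P₊(η₁ ⊗ ⋯ ⊗ ηₙ)`. -/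
def veeProd {n : ℕ} (η : Fin n → E) : SymTensorAlg E :=
  inclusion E n (symmetrize E n (PiTensorProduct.tprod ℂ η))

/-- `ξ^{∨I} = ξ₁ ∨ ⋯ ∨ ξ₁ ∨ ξ₂ ∨ ⋯`, with `ξⱼ` repeated `I j` times. -/
def veeMonomial (ξ : ℕ → E) (I : ℕ →₀ ℕ) : SymTensorAlg E :=
  veeProd E (fun r : Fin (I.toMultiset.sort (· ≤ ·)).length =>
    ξ ((I.toMultiset.sort (· ≤ ·)).get r))

/-- The `n!`-weighted inner product `⟨a, b⟩ = ∑ₙ n! ⟨aₙ, bₙ⟩` of the Fock space, on `T^∨(E)`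
(a sum with finitely many nonzero terms). -/
def fockInner (a b : SymTensorAlg E) : ℂ :=
  ∑ᶠ n : ℕ, (n.factorial : ℂ) *
    tensorInner E (component E n a : (⨂[ℂ]^n) E) (component E n b : (⨂[ℂ]^n) E)

theorem component_finite (a : SymTensorAlg E) : {n | component E n a ≠ 0}.Finite :=
  DFinsupp.finite_support (β := fun n => symTensor E n) a

theorem fock_finite (a b : SymTensorAlg E) :
    (Function.support fun n : ℕ => (n.factorial : ℂ) *
      tensorInner E (component E n a : (⨂[ℂ]^n) E) (component E n b : (⨂[ℂ]^n) E)).Finite := by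
  refine (component_finite E a).subset fun n hn h0 => hn ?_
  have : (0 : (⨂[ℂ]^n) E) = (0 : ℂ) • 0 := by simp
  simp only [h0, ZeroMemClass.coe_zero, tensorInner]
  rw [this, (tensorCore E n).smul_left]
  simp

/-- The `n!`-weighted inner product is an inner product on `T^∨(E)`. -/
@[reducible] def fockCore : InnerProductSpace.Core ℂ (SymTensorAlg E) where
  inner := fockInner E
  conj_inner_symm a b := by
    simp only [fockInner]
    rw [finsum_eq_sum_of_support_subset (s := (fock_finite E b a).toFinset ∪
        (fock_finite E a b).toFinset) _ (by simp),
      finsum_eq_sum_of_support_subset (s := (fock_finite E b a).toFinset ∪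
        (fock_finite E a b).toFinset) _ (by simp), map_sum]
    refine Finset.sum_congr rfl fun n _ => ?_
    rw [map_mul, tensorInner, (tensorCore E n).conj_inner_symm]
    simp [tensorInner]
  re_inner_nonneg a := by
    simp only [fockInner]
    rw [finsum_eq_sum _ (fock_finite E a a), map_sum]
    refine Finset.sum_nonneg fun n _ => ?_
    have := (tensorCore E n).re_inner_nonneg (component E n a : (⨂[ℂ]^n) E)
    have h2 : ((n.factorial : ℕ) : ℂ) = (((n.factorial : ℕ) : ℝ) : ℂ) := by simp
    rw [h2, RCLike.re_to_complex, Complex.re_ofReal_mul]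
    exact mul_nonneg (by positivity) this
  add_left a b c := by
    simp only [fockInner]
    rw [← finsum_add_distrib (fock_finite E a c) (fock_finite E b c)]
    refine finsum_congr fun n => ?_
    rw [map_add, Submodule.coe_add, tensorInner, (tensorCore E n).add_left, mul_add]
    rfl
  smul_left a b r := by
    simp only [fockInner]
    rw [← smul_eq_mul, smul_finsum' _ (fock_finite E a b)]
    refine finsum_congr fun n => ?_
    rw [map_smul, Submodule.coe_smul, tensorInner, (tensorCore E n).smul_left, mul_left_comm]
    rfl
  definite a h := by
    have hnn : ∀ n : ℕ, 0 ≤ RCLike.re ((n.factorial : ℂ) * tensorInner E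
        (component E n a : (⨂[ℂ]^n) E) (component E n a : (⨂[ℂ]^n) E)) := by
      intro n
      have := (tensorCore E n).re_inner_nonneg (component E n a : (⨂[ℂ]^n) E)
      have h2 : ((n.factorial : ℕ) : ℂ) = (((n.factorial : ℕ) : ℝ) : ℂ) := by simp
      rw [h2, RCLike.re_to_complex, Complex.re_ofReal_mul]
      exact mul_nonneg (by positivity) this
    have h' := congrArg RCLike.re h
    simp only [fockInner] at h'
    rw [finsum_eq_sum _ (fock_finite E a a), map_sum, map_zero,
      Finset.sum_eq_zero_iff_of_nonneg (fun n _ => hnn n)] at h'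
    have key : ∀ n, component E n a = 0 := by
      intro n
      have hre : RCLike.re ((n.factorial : ℂ) * tensorInner E
          (component E n a : (⨂[ℂ]^n) E) (component E n a : (⨂[ℂ]^n) E)) = 0 := by
        by_cases hn : n ∈ (fock_finite E a a).toFinset
        · exact h' n hn
        · have h0 := Function.notMem_support.mp (fun hh => hn ((Set.Finite.mem_toFinset _).2 hh))
          rw [h0, map_zero]
      have h2 : ((n.factorial : ℕ) : ℂ) = (((n.factorial : ℕ) : ℝ) : ℂ) := by simp
      rw [h2, RCLike.re_to_complex, Complex.re_ofReal_mul] at hre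
      have hre' := (mul_eq_zero.mp hre).resolve_left (by positivity)
      have him : (tensorInner E (component E n a : (⨂[ℂ]^n) E)
          (component E n a : (⨂[ℂ]^n) E)).im = 0 :=
        Complex.conj_eq_iff_im.mp ((tensorCore E n).conj_inner_symm _ _)
      exact Subtype.ext ((tensorCore E n).definite _ (Complex.ext hre' him))
    exact DFinsupp.ext (β := fun n => symTensor E n) key

instance : NormedAddCommGroup (SymTensorAlg E) := (fockCore E).toNormedAddCommGroup

instance : InnerProductSpace ℂ (SymTensorAlg E) := InnerProductSpace.ofCore (fockCore E).toCore

theorem inner_eq_fockInner (a b : SymTensorAlg E) : inner ℂ a b = fockInner E a b := rfl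

/-- The symmetric Fock space `F(E)`: the completion of `T^∨(E)` in the norm of the
`n!`-weighted inner product. -/
abbrev FockSpace : Type _ := UniformSpace.Completion (SymTensorAlg E)

end Tensor

/-! ### The dual of a Hilbert space, with the operator norm -/

section Dual

variable (E : Type*) [NormedAddCommGroup E] [InnerProductSpace ℂ E] [CompleteSpace E]

/-- The Hilbert space structure of the continuous dual, compatible with the operator norm:
`⟨f, g⟩ = ⟨g♯, f♯⟩`, where `f = ⟨f♯, ·⟩`. -/
instance dualInnerProductSpace : InnerProductSpace ℂ (StrongDual ℂ E) where
  inner f g := inner ℂ ((InnerProductSpace.toDual ℂ E).symm g)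
    ((InnerProductSpace.toDual ℂ E).symm f)
  norm_sq_eq_re_inner f := by
    rw [inner_self_eq_norm_sq, LinearIsometryEquiv.norm_map]
  conj_inner_symm f g := inner_conj_symm _ _
  add_left f g h := by rw [map_add, inner_add_right]
  smul_left f g r := by rw [map_smulₛₗ, inner_smul_right]

end Dual

/-! ### Covariance operators, Cameron–Martin space, Gaussian measures -/

section Gauss

variable {H : Type*} [NormedAddCommGroup H] [InnerProductSpace ℂ H] [CompleteSpace H]

/-- `K` is a (strictly) positive-definite trace-class operator on an infinite-dimensional
separable Hilbert space; for a positive operator, being trace class means that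
`∑ⱼ ⟨K bⱼ, bⱼ⟩ < ∞` for an orthonormal basis `b`. -/
structure IsPosDefTraceClass (K : H →L[ℂ] H) : Prop where
  isPositive : K.IsPositive
  pos : ∀ x : H, x ≠ 0 → 0 < RCLike.re (inner ℂ (K x) x)
  traceClass : ∃ b : HilbertBasis ℕ ℂ H, Summable fun j => RCLike.re (inner ℂ (K (b j)) (b j))

/-- The square root `K^{1/2}`. -/
def sqrtOp (K : H →L[ℂ] H) : H →L[ℂ] H := CFC.sqrt K

theorem sqrtOp_injective {K : H →L[ℂ] H} (hK : IsPosDefTraceClass K) :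
    Function.Injective (sqrtOp K : H →ₗ[ℂ] H) := by
  have h0 : (0 : H →L[ℂ] H) ≤ K := (ContinuousLinearMap.nonneg_iff_isPositive K).2 hK.isPositive
  have hs : sqrtOp K * sqrtOp K = K := CFC.sqrt_mul_sqrt_self K h0
  rw [← LinearMap.ker_eq_bot, LinearMap.ker_eq_bot']
  intro x hx
  by_contra hne
  have hx' : sqrtOp K x = 0 := hx
  have hKx : K x = 0 := by
    rw [← hs, mul_apply_eq_comp, hx', map_zero]
  have := hK.pos x hne
  rw [hKx, inner_zero_left, map_zero] at this
  exact lt_irrefl _ this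

/-- The Cameron–Martin space `H_μ = {ξ ∈ H : ‖K^{-1/2} ξ‖ < ∞}`, i.e. the range of `K^{1/2}`. -/
def CameronMartin {K : H →L[ℂ] H} (_hK : IsPosDefTraceClass K) : Type _ :=
  LinearMap.range (sqrtOp K : H →ₗ[ℂ] H)

variable {K : H →L[ℂ] H} (hK : IsPosDefTraceClass K)

instance : AddCommGroup (CameronMartin hK) :=
  inferInstanceAs (AddCommGroup (LinearMap.range (sqrtOp K : H →ₗ[ℂ] H)))

instance : Module ℂ (CameronMartin hK) :=
  inferInstanceAs (Module ℂ (LinearMap.range (sqrtOp K : H →ₗ[ℂ] H)))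

/-- `K^{-1/2}` as a bijection from `H_μ` onto `H`. -/
def invSqrt : CameronMartin hK ≃ₗ[ℂ] H :=
  (LinearEquiv.ofInjective (sqrtOp K : H →ₗ[ℂ] H) (sqrtOp_injective hK)).symm

/-- The inclusion `H_μ ⊂ H`. -/
def cmIncl : CameronMartin hK →ₗ[ℂ] H := (LinearMap.range (sqrtOp K : H →ₗ[ℂ] H)).subtype

theorem sqrtOp_invSqrt (x : CameronMartin hK) : sqrtOp K (invSqrt hK x) = cmIncl hK x :=
  congrArg Subtype.val
    ((LinearEquiv.ofInjective (sqrtOp K : H →ₗ[ℂ] H) (sqrtOp_injective hK)).apply_symm_apply x)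

/-- `⟨ξ, η⟩_{H_μ} = ⟨K^{-1/2} ξ, K^{-1/2} η⟩`. -/
@[reducible] def cmCore : InnerProductSpace.Core ℂ (CameronMartin hK) :=
  coreOfInjective (invSqrt hK).toLinearMap (invSqrt hK).injective

instance : NormedAddCommGroup (CameronMartin hK) := (cmCore hK).toNormedAddCommGroup

instance : InnerProductSpace ℂ (CameronMartin hK) := InnerProductSpace.ofCore (cmCore hK).toCore

theorem cm_inner (x y : CameronMartin hK) :
    inner ℂ x y = inner ℂ (invSqrt hK x) (invSqrt hK y) := rfl

/-- `K^{-1/2}` is an isometry of `H_μ` onto `H`. -/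
def invSqrtIsometry : CameronMartin hK ≃ₗᵢ[ℂ] H :=
  (invSqrt hK).isometryOfInner fun x y => (cm_inner hK x y).symm

instance : CompleteSpace (CameronMartin hK) :=
  (invSqrtIsometry hK).toIsometryEquiv.completeSpace

/-- The dual `H_μ^*` of the Cameron–Martin space. -/
abbrev CameronMartinDual : Type _ := StrongDual ℂ (CameronMartin hK)

/-- The inclusion `H_μ → H` as a bounded map. -/
def cmInclL : CameronMartin hK →L[ℂ] H :=
  (sqrtOp K).comp (invSqrtIsometry hK).toLinearIsometry.toContinuousLinearMap

theorem cmInclL_apply (x : CameronMartin hK) : cmInclL hK x = cmIncl hK x :=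
  sqrtOp_invSqrt hK x

/-- The embedding `H → H_μ^*`: the vector `η ∈ H`, identified with `⟨η, ·⟩_H ∈ H^*`, is sent to
the restriction of this functional to `H_μ`. -/
def toCMDual (η : H) : CameronMartinDual hK := (innerSL ℂ η).comp (cmInclL hK)

theorem toCMDual_apply (η : H) (x : CameronMartin hK) :
    toCMDual hK η x = inner ℂ η (cmIncl hK x) := by
  rw [← cmInclL_apply]; rfl

variable [MeasurableSpace H]

/-- The Fourier transform of `μ` is `ξ ↦ exp (-¼ ⟨ξ, K ξ⟩)`; the functional `⟨ξ, ·⟩` enters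
through its real part, so that the coordinates are circularly symmetric complex Gaussians and
`∫ |⟨ξ, x⟩|² dμ(x) = ⟨ξ, K ξ⟩`. -/
def HasCovarianceOperator (μ : Measure H) (K : H →L[ℂ] H) : Prop :=
  ∀ ξ : H, ∫ x, Complex.exp (Complex.I * ((RCLike.re (inner ℂ ξ x) : ℝ) : ℂ)) ∂μ =
    Complex.exp (-(1 / 4 : ℂ) * inner ℂ ξ (K ξ))

/-- The monomial `z^I`, where `z_j = ⟨ξ_j, ·⟩` is the `j`-th coordinate function. -/
def monomialFun (ξ : HilbertBasis ℕ ℂ H) (I : ℕ →₀ ℕ) (x : H) : ℂ :=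
  I.prod fun j i => (inner ℂ (ξ j) x) ^ i

theorem norm_monomialFun_le (ξ : HilbertBasis ℕ ℂ H) (I : ℕ →₀ ℕ) (x : H) :
    ‖monomialFun ξ I x‖ ≤ ‖x‖ ^ (∑ j ∈ I.support, I j) := by
  rw [monomialFun, Finsupp.prod, norm_prod, ← Finset.prod_pow_eq_pow_sum]
  refine Finset.prod_le_prod (fun _ _ => norm_nonneg _) fun j _ => ?_
  rw [norm_pow]
  refine pow_le_pow_left₀ (norm_nonneg _) ?_ _
  have := norm_inner_le_norm (𝕜 := ℂ) (ξ j) x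
  rwa [ξ.orthonormal.1 j, one_mul] at this

variable [BorelSpace H] [SeparableSpace H] (μ : Measure H) [IsGaussian μ]

theorem memLp_monomialFun (ξ : HilbertBasis ℕ ℂ H) (I : ℕ →₀ ℕ) :
    MemLp (monomialFun ξ I) 2 μ := by
  have : SecondCountableTopology H := UniformSpace.secondCountable_of_separable H
  have hc : Continuous (monomialFun ξ I) := by
    unfold monomialFun Finsupp.prod
    fun_prop
  rw [memLp_two_iff_integrable_sq_norm hc.aestronglyMeasurable]
  have hint : Integrable (fun x : H => ‖x‖ ^ (2 * ∑ j ∈ I.support, I j)) μ := by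
    have h := IsGaussian.memLp_id μ ((2 * ∑ j ∈ I.support, I j : ℕ) : ENNReal)
      (ENNReal.natCast_ne_top _)
    exact h.integrable_norm_pow'
  refine hint.mono' (by fun_prop) (Filter.Eventually.of_forall fun x => ?_)
  rw [Real.norm_of_nonneg (by positivity), pow_mul']
  exact pow_le_pow_left₀ (norm_nonneg _) (norm_monomialFun_le ξ I x) 2

/-- The class of `z^I` in `L²(H, μ)`. -/
def monomialLp (ξ : HilbertBasis ℕ ℂ H) (I : ℕ →₀ ℕ) : Lp ℂ 2 μ :=
  (memLp_monomialFun μ ξ I).toLp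

/-- The space of polynomials `∑_I c_I z^I` (finite sums), in `L²(H, μ)`. -/
def polynomials (ξ : HilbertBasis ℕ ℂ H) : Submodule ℂ (Lp ℂ 2 μ) :=
  Submodule.span ℂ (Set.range (monomialLp μ ξ))

/-- The Segal–Bargmann space `HL²(H, μ)`: the functions in `L²(H, μ)` of the form
`f = ∑_I a_I z^I`, the series converging in `L²(H, μ)`. -/
def segalBargmann (ξ : HilbertBasis ℕ ℂ H) : Submodule ℂ (Lp ℂ 2 μ) where
  carrier := {f | ∃ a : (ℕ →₀ ℕ) → ℂ, HasSum (fun I => a I • monomialLp μ ξ I) f}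
  add_mem' := by
    rintro f g ⟨a, ha⟩ ⟨b, hb⟩
    exact ⟨a + b, by simpa only [Pi.add_apply, add_smul] using ha.add hb⟩
  zero_mem' := ⟨0, by simp⟩
  smul_mem' := by
    rintro c f ⟨a, ha⟩
    exact ⟨c • a, by simpa only [Pi.smul_apply, smul_assoc] using ha.const_smul c⟩

end Gauss

end SegalFock

end

noncomputable section

namespace SegalFock

section Tensor

variable {E : Type*} [NormedAddCommGroup E] [InnerProductSpace ℂ E]

/-! ### Inner products of symmetric products -/

/-! The `ξ^{∨I}` and the `z^I` are orthogonal families with the same squared norms `∏ⱼ iⱼ!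
kⱼ^{2iⱼ}`, and the first is total in the Fock space. Rescaling both to orthonormal families gives an
isometry whose range is exactly the set of convergent series `∑ a_I z^I`
(`exists_isometryEquiv_of_orthogonal`).

On the Fock side, the weight `n!` makes the inner product of two symmetric products the permanent of
their Gram matrix (`inner_veeProd`). The functionals of the `ξⱼ` on the Cameron–Martin space are
orthogonal with squared norms `kⱼ²` (`inner_toCMDual_eigenbasis`), so only permutations fixing the
repeated tuple contribute, and there are `∏ⱼ iⱼ!` of them. On the Gaussian side, evaluating the
Fourier transform at finite sums `∑ tⱼ ξⱼ` shows that the coordinates are independent circular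
Gaussians (`map_coord`, `iIndepFun_coords`), and the moments of such a variable produce the same
factorials and powers.

Multiplicativity is clear on monomials, but `T^∨` contains more than their span, and a product of
two `L²` functions is in general only in `L¹`. The identity is therefore stated in `L¹`, where for
`(η₁ ∨ ⋯ ∨ ηₙ) ∨ (ζ₁ ∨ ⋯ ∨ ζₘ)` both sides are bounded in each vector separately. It extends from
basis vectors to arbitrary vectors one slot at a time (`tuple_induction`), and then by bilinearity.
-/

theorem tensorInner_sum_smul_left {n : ℕ} {ι : Type*} (s : Finset ι) (c : ℂ)
    (f : ι → (⨂[ℂ]^n) E) (t : (⨂[ℂ]^n) E) :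
    tensorInner E (c • ∑ i ∈ s, f i) t = starRingEnd ℂ c * ∑ i ∈ s, tensorInner E (f i) t := by
  classical
  rw [tensorInner, (tensorCore E n).smul_left]
  congr 1
  induction s using Finset.induction_on with
  | empty =>
    have : (0 : (⨂[ℂ]^n) E) = (0 : ℂ) • 0 := by simp
    rw [Finset.sum_empty, Finset.sum_empty, this, (tensorCore E n).smul_left]
    simp
  | insert i s hi ih =>
    rw [Finset.sum_insert hi, Finset.sum_insert hi, (tensorCore E n).add_left, ih]
    rfl

theorem tensorInner_conj_symm {n : ℕ} (s t : (⨂[ℂ]^n) E) :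
    starRingEnd ℂ (tensorInner E t s) = tensorInner E s t :=
  (tensorCore E n).conj_inner_symm s t

theorem tensorInner_sum_smul_right {n : ℕ} {ι : Type*} (s : Finset ι) (c : ℂ)
    (f : ι → (⨂[ℂ]^n) E) (t : (⨂[ℂ]^n) E) :
    tensorInner E t (c • ∑ i ∈ s, f i) = c * ∑ i ∈ s, tensorInner E t (f i) := by
  rw [← tensorInner_conj_symm, tensorInner_sum_smul_left, map_mul, map_sum]
  simp only [tensorInner_conj_symm, Complex.conj_conj]

theorem coe_symmetrize {n : ℕ} (t : (⨂[ℂ]^n) E) :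
    (symmetrize E n t : (⨂[ℂ]^n) E) =
      ((n.factorial : ℂ)⁻¹) • ∑ σ : Equiv.Perm (Fin n), permute E σ t := by
  change (((n.factorial : ℂ)⁻¹) • ∑ σ : Equiv.Perm (Fin n), permute E σ) t = _
  rw [LinearMap.smul_apply, LinearMap.sum_apply]

/-- A term of the double sum over `σ, τ` depends only on the relative permutation, so summing over
`σ` cancels one `1/n!` and the Fock weight cancels the other. -/
theorem tensorInner_symmetrize_tprod {n : ℕ} (x y : Fin n → E) :
    (n.factorial : ℂ) * tensorInner E (symmetrize E n (PiTensorProduct.tprod ℂ x) : (⨂[ℂ]^n) E)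
      (symmetrize E n (PiTensorProduct.tprod ℂ y) : (⨂[ℂ]^n) E) =
      ∑ σ : Equiv.Perm (Fin n), ∏ i, inner ℂ (x i) (y (σ i)) := by
  have hσ : ∀ σ : Equiv.Perm (Fin n), ∑ τ : Equiv.Perm (Fin n),
      tensorInner E (permute E σ (PiTensorProduct.tprod ℂ x))
        (permute E τ (PiTensorProduct.tprod ℂ y)) =
      ∑ σ : Equiv.Perm (Fin n), ∏ i, inner ℂ (x i) (y (σ i)) := by
    intro σ
    -- The substitution is `τ ↦ τ⁻¹ * σ`, matched by reindexing the factors by `σ`.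
    refine Fintype.sum_equiv ((Equiv.inv _).trans (Equiv.mulRight σ)) _ _ fun τ => ?_
    rw [permute_tprod, permute_tprod, tensorInner_tprod, ← Equiv.prod_comp σ]
    simp [Equiv.Perm.mul_apply, Equiv.Perm.inv_def]
  rw [coe_symmetrize, coe_symmetrize, tensorInner_sum_smul_left]
  simp_rw [tensorInner_sum_smul_right, ← Finset.mul_sum, hσ]
  rw [Finset.sum_const, Finset.card_univ, Fintype.card_perm, Fintype.card_fin]
  have : (n.factorial : ℂ) ≠ 0 := by exact_mod_cast n.factorial_ne_zero
  simp only [map_inv₀, map_natCast, nsmul_eq_mul]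
  field_simp

theorem component_inclusion_same (n : ℕ) (a : symTensor E n) :
    component E n (inclusion E n a) = a :=
  DirectSum.component.lof_self (R := ℂ) (M := fun n => symTensor E n) n a

theorem component_inclusion_ne {n m : ℕ} (h : n ≠ m) (a : symTensor E n) :
    component E m (inclusion E n a) = 0 :=
  DFinsupp.single_eq_of_ne (β := fun n => symTensor E n) h.symm

theorem inner_inclusion (n : ℕ) (a b : symTensor E n) :
    inner ℂ (inclusion E n a) (inclusion E n b) =
      (n.factorial : ℂ) * tensorInner E (a : (⨂[ℂ]^n) E) (b : (⨂[ℂ]^n) E) := by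
  rw [inner_eq_fockInner, fockInner, finsum_eq_single _ n, component_inclusion_same,
    component_inclusion_same]
  intro m hm
  have h0 := tensorInner_sum_smul_left (E := E) (n := m) (∅ : Finset ℕ) 0 0 0
  simp only [Finset.sum_empty, smul_zero, mul_zero] at h0
  simp [component_inclusion_ne hm.symm, h0]

theorem inner_inclusion_ne {n m : ℕ} (h : n ≠ m) (a : symTensor E n) (b : symTensor E m) :
    inner ℂ (inclusion E n a) (inclusion E m b) = 0 := by
  rw [inner_eq_fockInner, fockInner]
  refine finsum_eq_zero_of_forall_eq_zero fun l => ?_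
  by_cases hl : n = l
  · subst hl
    have h0 := tensorInner_sum_smul_right (E := E) (n := n) (∅ : Finset ℕ) 0 0 (a : (⨂[ℂ]^n) E)
    simp only [Finset.sum_empty, smul_zero, mul_zero] at h0
    simp [component_inclusion_ne h.symm, component_inclusion_same, h0]
  · have h0 := tensorInner_sum_smul_left (E := E) (n := l) (∅ : Finset ℕ) 0 0
      (component E l (inclusion E m b) : (⨂[ℂ]^l) E)
    simp only [Finset.sum_empty, smul_zero, mul_zero] at h0
    simp [component_inclusion_ne hl, h0]

theorem inner_veeProd {n : ℕ} (x y : Fin n → E) :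
    inner ℂ (veeProd E x) (veeProd E y) =
      ∑ σ : Equiv.Perm (Fin n), ∏ i, inner ℂ (x i) (y (σ i)) := by
  rw [veeProd, veeProd, inner_inclusion, tensorInner_symmetrize_tprod]

theorem inner_veeProd_ne {n m : ℕ} (h : n ≠ m) (x : Fin n → E) (y : Fin m → E) :
    inner ℂ (veeProd E x) (veeProd E y) = 0 :=
  inner_inclusion_ne h _ _

/-- The permanent has `n!` terms, each at most `(∏ᵢ ‖xᵢ‖)²` by Cauchy–Schwarz. This bound makes the
`n`-fold symmetric product continuous in every slot. -/
theorem norm_veeProd_le {n : ℕ} (x : Fin n → E) :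
    ‖veeProd E x‖ ≤ √(n.factorial : ℝ) * ∏ i, ‖x i‖ := by
  have h : ‖veeProd E x‖ ^ 2 ≤ (n.factorial : ℝ) * (∏ i, ‖x i‖) ^ 2 := by
    have h1 : ‖veeProd E x‖ ^ 2 = ‖inner ℂ (veeProd E x) (veeProd E x)‖ := by
      rw [inner_self_eq_norm_sq_to_K]
      simp
    rw [h1, inner_veeProd]
    refine (norm_sum_le _ _).trans ((Finset.sum_le_card_nsmul _ _ ((∏ i, ‖x i‖) ^ 2) ?_).trans ?_)
    · intro σ _
      rw [norm_prod, sq]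
      nth_rewrite 2 [← Equiv.prod_comp σ]
      rw [← Finset.prod_mul_distrib]
      exact Finset.prod_le_prod (fun _ _ => norm_nonneg _) fun i _ => (norm_inner_le_norm _ _).trans_eq (mul_comm _ _)
    · simp [Fintype.card_perm]
  refine abs_le_of_sq_le_sq' ?_ (by positivity) |>.2
  rwa [mul_pow, Real.sq_sqrt (by positivity)]

/-- `(η₁, …, ηₙ) ↦ η₁ ∨ ⋯ ∨ ηₙ` as a bounded multilinear map. -/
def veeProdL (n : ℕ) : ContinuousMultilinearMap ℂ (fun _ : Fin n => E) (SymTensorAlg E) :=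
  MultilinearMap.mkContinuous
    ((inclusion E n ∘ₗ symmetrize E n).compMultilinearMap (PiTensorProduct.tprod ℂ))
    (√(n.factorial : ℝ)) norm_veeProd_le

/-! ### The product of symmetric products -/

theorem symmetrize_permute {n : ℕ} (σ : Equiv.Perm (Fin n)) (t : (⨂[ℂ]^n) E) :
    symmetrize E n (permute E σ t) = symmetrize E n t := by
  apply Subtype.ext
  rw [coe_symmetrize, coe_symmetrize]
  simp_rw [permute_permute]
  congr 1
  exact Fintype.sum_equiv (Equiv.mulRight σ) _ _ fun τ => rfl

theorem veeProd_comp_perm {n : ℕ} (σ : Equiv.Perm (Fin n)) (x : Fin n → E) :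
    veeProd E (x ∘ σ) = veeProd E x := by
  have := symmetrize_permute (σ.symm) (PiTensorProduct.tprod ℂ x)
  rw [permute_tprod] at this
  exact congrArg (inclusion E n) this

theorem symmetrize_coe {n : ℕ} (a : symTensor E n) :
    symmetrize E n (a : (⨂[ℂ]^n) E) = a := by
  apply Subtype.ext
  rw [coe_symmetrize]
  have h : ∀ σ : Equiv.Perm (Fin n), permute E σ (a : (⨂[ℂ]^n) E) = a := a.2
  have hn : (n.factorial : ℂ) ≠ 0 := by exact_mod_cast n.factorial_ne_zero
  simp_rw [h]
  rw [Finset.sum_const, Finset.card_univ, Fintype.card_perm, Fintype.card_fin,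
    ← Nat.cast_smul_eq_nsmul ℂ, smul_smul, inv_mul_cancel₀ hn, one_smul]

theorem tensorMul_tprod {n m : ℕ} (x : Fin n → E) (y : Fin m → E) :
    tensorMul E n m (PiTensorProduct.tprod ℂ x) (PiTensorProduct.tprod ℂ y) =
      PiTensorProduct.tprod ℂ (Fin.append x y) :=
  TensorPower.tprod_mul_tprod ℂ x y

/-- Permutations inside the two blocks are permutations of all `n + m` factors, which the outer
symmetrisation absorbs. The `n! m!` terms are then equal and cancel the normalisation. -/
theorem vee_veeProd {n m : ℕ} (x : Fin n → E) (y : Fin m → E) :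
    vee E (veeProd E x) (veeProd E y) = veeProd E (Fin.append x y) := by
  rw [veeProd, veeProd, vee_inclusion, veeProd, coe_symmetrize, coe_symmetrize]
  congr 1
  simp only [map_smul, map_sum, LinearMap.smul_apply, LinearMap.sum_apply]
  have h : ∀ (σ : Equiv.Perm (Fin n)) (τ : Equiv.Perm (Fin m)),
      symmetrize E (n + m) (tensorMul E n m (permute E σ (PiTensorProduct.tprod ℂ x))
        (permute E τ (PiTensorProduct.tprod ℂ y))) =
      symmetrize E (n + m) (PiTensorProduct.tprod ℂ (Fin.append x y)) := by
    intro σ τ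
    rw [permute_tprod, permute_tprod, tensorMul_tprod,
      ← symmetrize_permute (finSumFinEquiv.permCongr (Equiv.Perm.sumCongr σ τ))
        (PiTensorProduct.tprod ℂ (Fin.append x y)), permute_tprod]
    congr 2
    funext i
    refine Fin.addCases (fun i => ?_) (fun i => ?_) i
    · simp [Equiv.permCongr_def]
    · simp [Equiv.permCongr_def]
  simp_rw [h]
  have hn : (n.factorial : ℂ) ≠ 0 := by exact_mod_cast n.factorial_ne_zero
  have hm : (m.factorial : ℂ) ≠ 0 := by exact_mod_cast m.factorial_ne_zero
  simp only [Finset.sum_const, Finset.card_univ, Fintype.card_perm, Fintype.card_fin,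
    ← Nat.cast_smul_eq_nsmul ℂ, smul_smul]
  field_simp
  simp

theorem span_veeProd_eq_top :
    Submodule.span ℂ (⋃ n, Set.range fun x : Fin n → E => veeProd E x) = ⊤ := by
  rw [eq_top_iff]
  rintro a -
  induction a using DirectSum.induction_on with
  | zero => exact Submodule.zero_mem _
  | add a b ha hb => exact Submodule.add_mem _ ha hb
  | of n a =>
    change inclusion E n a ∈ _
    rw [← symmetrize_coe a]
    have h : (a : (⨂[ℂ]^n) E) ∈ Submodule.span ℂ (Set.range (PiTensorProduct.tprod ℂ)) := by
      rw [PiTensorProduct.span_tprod_eq_top]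
      trivial
    generalize (a : (⨂[ℂ]^n) E) = t at h
    induction h using Submodule.span_induction with
    | mem t ht =>
      obtain ⟨x, rfl⟩ := ht
      exact Submodule.subset_span (Set.mem_iUnion.2 ⟨n, x, rfl⟩)
    | zero => simp
    | add s t _ _ hs ht =>
      rw [map_add, map_add]
      exact Submodule.add_mem _ hs ht
    | smul c t _ ht =>
      rw [map_smul, map_smul]
      exact Submodule.smul_mem _ c ht

end Tensor

section Monomial

/-! ### Multi-indices and tuples -/

/-- Equal multisets of values have the same sorted list, so the two sorting permutations can be
composed. -/
theorem exists_perm_of_map_univ_eq {n : ℕ} {f g : Fin n → ℕ}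
    (h : (Finset.univ : Finset (Fin n)).val.map f = Finset.univ.val.map g) :
    ∃ σ : Equiv.Perm (Fin n), f = g ∘ σ := by
  have hs : f ∘ Tuple.sort f = g ∘ Tuple.sort g := by
    apply List.ofFn_injective
    refine List.Perm.eq_of_sortedLE (Tuple.monotone_sort f).sortedLE_ofFn
      (Tuple.monotone_sort g).sortedLE_ofFn ?_
    refine (Equiv.Perm.ofFn_comp_perm _ _).trans
      (List.Perm.trans ?_ (Equiv.Perm.ofFn_comp_perm _ _).symm)
    rw [Fin.univ_val_map, Fin.univ_val_map] at h
    exact Multiset.coe_eq_coe.1 h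
  refine ⟨(Tuple.sort f).symm.trans (Tuple.sort g), ?_⟩
  have := congrArg (· ∘ (Tuple.sort f).symm) hs
  simp only [Function.comp_assoc] at this
  simpa using this

/-- The increasing tuple in which `j` occurs `I j` times. -/
def sortedTuple (I : ℕ →₀ ℕ) : Fin (I.toMultiset.sort (· ≤ ·)).length → ℕ :=
  fun r => (I.toMultiset.sort (· ≤ ·)).get r

theorem map_sortedTuple (I : ℕ →₀ ℕ) :
    (Finset.univ : Finset (Fin _)).val.map (sortedTuple I) = I.toMultiset := by
  rw [Fin.univ_val_map]
  unfold sortedTuple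
  rw [List.ofFn_get, Multiset.sort_eq]

/-- The multi-index counting the occurrences in a tuple. -/
def tupleIndex {n : ℕ} (j : Fin n → ℕ) : ℕ →₀ ℕ :=
  Multiset.toFinsupp ((Finset.univ : Finset (Fin n)).val.map j)

theorem toMultiset_tupleIndex {n : ℕ} (j : Fin n → ℕ) :
    (tupleIndex j).toMultiset = (Finset.univ : Finset (Fin n)).val.map j :=
  Multiset.toFinsupp_toMultiset _

theorem prod_comp_tuple {M : Type*} [CommMonoid M] {n : ℕ} (j : Fin n → ℕ) (I : ℕ →₀ ℕ)
    (h : (Finset.univ : Finset (Fin n)).val.map j = I.toMultiset) (f : ℕ → M) :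
    ∏ r, f (j r) = I.prod fun a i => f a ^ i := by
  rw [Finset.prod_eq_multiset_prod, ← Function.comp_def f j, ← Multiset.map_map, h,
    Finsupp.toMultiset_map, Finsupp.prod_toMultiset,
    Finsupp.prod_mapDomain_index (fun _ => pow_zero _) (fun _ _ _ => pow_add _ _ _)]

theorem card_fiber_tuple {n : ℕ} (j : Fin n → ℕ) (I : ℕ →₀ ℕ)
    (h : (Finset.univ : Finset (Fin n)).val.map j = I.toMultiset) (a : ℕ) :
    Fintype.card {r // j r = a} = I a := by
  rw [← Finsupp.count_toMultiset I a, ← h, Multiset.count_map, Fintype.card_subtype]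
  simp only [eq_comm (a := a)]
  rfl

theorem image_tuple {n : ℕ} (j : Fin n → ℕ) (I : ℕ →₀ ℕ)
    (h : (Finset.univ : Finset (Fin n)).val.map j = I.toMultiset) :
    Finset.univ.image j = I.support := by
  rw [← Finsupp.toFinset_toMultiset, ← h]
  rfl

/-- The squared norm `∏ⱼ iⱼ! kⱼ^{2 iⱼ}` of the monomial `z^I`. -/
def monomialNormSq (k : ℕ → ℝ) (I : ℕ →₀ ℕ) : ℝ :=
  I.prod fun j i => (i.factorial : ℝ) * (k j ^ 2) ^ i

theorem monomialNormSq_pos {k : ℕ → ℝ} (hk : ∀ j, 0 < k j) (I : ℕ →₀ ℕ) :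
    0 < monomialNormSq k I :=
  Finset.prod_pos fun j _ => by have := hk j; positivity

variable {E : Type*} [NormedAddCommGroup E] [InnerProductSpace ℂ E]

theorem veeMonomial_eq (e : ℕ → E) (I : ℕ →₀ ℕ) :
    veeMonomial E e I = veeProd E (e ∘ sortedTuple I) := rfl

theorem veeProd_comp_eq_of_map_eq (e : ℕ → E) {n m : ℕ} (f : Fin n → ℕ) (g : Fin m → ℕ)
    (h : (Finset.univ : Finset (Fin n)).val.map f = Finset.univ.val.map g) :
    veeProd E (e ∘ f) = veeProd E (e ∘ g) := by
  have hnm : n = m := by simpa using congrArg Multiset.card h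
  subst hnm
  obtain ⟨σ, rfl⟩ := exists_perm_of_map_univ_eq h
  exact veeProd_comp_perm σ (e ∘ g)

theorem veeProd_comp (e : ℕ → E) {n : ℕ} (f : Fin n → ℕ) :
    veeProd E (e ∘ f) = veeMonomial E e (tupleIndex f) :=
  veeProd_comp_eq_of_map_eq e _ _ 
    ((toMultiset_tupleIndex f).symm.trans (map_sortedTuple (tupleIndex f)).symm)

/-- In equal degree every term of the permanent has a zero factor, since otherwise the two tuples
would be rearrangements of each other. Different degrees are orthogonal by construction. -/
theorem inner_veeMonomial_ne {e : ℕ → E} (he : ∀ i j, i ≠ j → inner ℂ (e i) (e j) = 0)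
    {I J : ℕ →₀ ℕ} (h : I ≠ J) :
    inner ℂ (veeMonomial E e I) (veeMonomial E e J) = 0 := by
  have key : ∀ {n m : ℕ} (f : Fin n → ℕ) (g : Fin m → ℕ),
      (Finset.univ : Finset (Fin n)).val.map f ≠ Finset.univ.val.map g →
      inner ℂ (veeProd E (e ∘ f)) (veeProd E (e ∘ g)) = 0 := by
    intro n m f g hfg
    by_cases hnm : n = m
    · subst hnm
      rw [inner_veeProd]
      refine Finset.sum_eq_zero fun σ _ => ?_
      have hne : f ≠ g ∘ σ := by
        rintro rfl
        refine hfg ?_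
        rw [Fin.univ_val_map, Fin.univ_val_map]
        exact Multiset.coe_eq_coe.2 (Equiv.Perm.ofFn_comp_perm σ g)
      obtain ⟨i, hi⟩ := Function.ne_iff.1 hne
      exact Finset.prod_eq_zero (Finset.mem_univ i) (he _ _ hi)
    · exact inner_veeProd_ne hnm _ _
  refine key _ _ ?_
  exact fun h' => h (Multiset.toFinsupp.symm.injective
    ((map_sortedTuple I).symm.trans (h'.trans (map_sortedTuple J))))

/-- A permutation contributes only if it stabilises the tuple. The stabiliser is a product of
symmetric groups of the fibres, of order `∏ⱼ iⱼ!`. -/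
theorem inner_veeMonomial_self {e : ℕ → E} {k : ℕ → ℝ}
    (he : ∀ i j, inner ℂ (e i) (e j) = if i = j then ((k i ^ 2 : ℝ) : ℂ) else 0) (I : ℕ →₀ ℕ) :
    inner ℂ (veeMonomial E e I) (veeMonomial E e I) = (monomialNormSq k I : ℂ) := by
  have hI := map_sortedTuple I
  rw [veeMonomial_eq, inner_veeProd]
  generalize sortedTuple I = f at hI
  have h1 : ∀ σ : Equiv.Perm (Fin (I.toMultiset.sort (· ≤ ·)).length),
      ∏ r, inner ℂ ((e ∘ f) r) ((e ∘ f) (σ r)) =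
        if f ∘ σ = f then ∏ r, ((k (f r) ^ 2 : ℝ) : ℂ) else 0 := by
    intro σ
    split_ifs with hσ
    · refine Finset.prod_congr rfl fun r _ => ?_
      rw [Function.comp_apply, Function.comp_apply, he, if_pos]
      exact (congrFun hσ r).symm
    · obtain ⟨r, hr⟩ := Function.ne_iff.1 hσ
      refine Finset.prod_eq_zero (Finset.mem_univ r) ?_
      rw [Function.comp_apply, Function.comp_apply, he, if_neg]
      exact Ne.symm hr
  simp_rw [h1]
  rw [← Finset.sum_filter, Finset.sum_const, ← Fintype.card_subtype, DomMulAct.stabilizer_card',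
    image_tuple f I hI, prod_comp_tuple f I hI (fun a => ((k a ^ 2 : ℝ) : ℂ)), nsmul_eq_mul]
  simp only [card_fiber_tuple f I hI]
  rw [monomialNormSq, Finsupp.prod, Finsupp.prod, Finset.prod_mul_distrib]
  push_cast
  rfl

/-! ### Density -/

/-- With the other slots frozen, the admissible entries form a closed subspace; once it contains
every `e j` it is everything. The induction is on the set of slots freed from being basis vectors.
-/
theorem tuple_induction {e : ℕ → E} (he : (Submodule.span ℂ (Set.range e)).topologicalClosure = ⊤)
    {n : ℕ} {P : (Fin n → E) → Prop} (base : ∀ j : Fin n → ℕ, P (e ∘ j))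
    (closed : ∀ x i, ∃ V : Submodule ℂ E, IsClosed (V : Set E) ∧
      ∀ η, η ∈ V ↔ P (Function.update x i η)) (x : Fin n → E) : P x := by
  have key : ∀ (s : Finset (Fin n)) (x : Fin n → E), (∀ i ∉ s, x i ∈ Set.range e) → P x := by
    intro s
    induction s using Finset.induction_on with
    | empty =>
      intro x hx
      choose j hj using fun i => hx i (Finset.notMem_empty i)
      have : x = e ∘ j := funext fun i => (hj i).symm
      exact this ▸ base j
    | insert i s hi ih =>
      intro x hx
      obtain ⟨V, hV, hVP⟩ := closed x i
      have hle : Submodule.span ℂ (Set.range e) ≤ V := by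
        rw [Submodule.span_le]
        rintro _ ⟨j, rfl⟩
        refine (hVP _).2 (ih _ fun l hl => ?_)
        by_cases hli : l = i
        · subst hli
          rw [Function.update_self]
          exact ⟨j, rfl⟩
        · rw [Function.update_of_ne hli]
          exact hx l (by simp [hli, hl])
      have htop : V = ⊤ := by
        rw [eq_top_iff, ← he]
        exact Submodule.topologicalClosure_minimal _ hle hV
      have := (hVP (x i)).1 (htop ▸ Submodule.mem_top)
      rwa [Function.update_eq_self] at this
  exact key Finset.univ x fun i hi => absurd (Finset.mem_univ i) hi

theorem span_veeMonomial_dense {e : ℕ → E}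
    (he : (Submodule.span ℂ (Set.range e)).topologicalClosure = ⊤) :
    (Submodule.span ℂ (Set.range (veeMonomial E e))).topologicalClosure = ⊤ := by
  rw [eq_top_iff, ← span_veeProd_eq_top, Submodule.span_le]
  refine Set.iUnion_subset fun n => ?_
  rintro _ ⟨x, rfl⟩
  refine tuple_induction he (P := fun x => veeProd E x ∈ (_ : Submodule ℂ (SymTensorAlg E)))
    (fun j => ?_) (fun x i => ?_) x
  · rw [veeProd_comp]
    exact Submodule.le_topologicalClosure _ (Submodule.subset_span ⟨_, rfl⟩)
  · refine ⟨(Submodule.span ℂ (Set.range (veeMonomial E e))).topologicalClosure.comap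
      ((veeProdL n).toContinuousLinearMap x i).toLinearMap, ?_, fun η => Iff.rfl⟩
    exact (Submodule.isClosed_topologicalClosure _).preimage
      ((veeProdL n).toContinuousLinearMap x i).continuous

theorem span_veeMonomial_coe_dense {e : ℕ → E}
    (he : (Submodule.span ℂ (Set.range e)).topologicalClosure = ⊤) :
    ⊤ ≤ (Submodule.span ℂ (Set.range fun I => (veeMonomial E e I : FockSpace E))
      ).topologicalClosure := by
  have h1 : DenseRange ((↑) : SymTensorAlg E → FockSpace E) :=
    UniformSpace.Completion.denseRange_coe
  have h2 := (Submodule.dense_iff_topologicalClosure_eq_top.2 (span_veeMonomial_dense he))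
  have h3 := h1.dense_image (UniformSpace.Completion.continuous_coe _) h2
  rw [top_le_iff, ← Submodule.dense_iff_topologicalClosure_eq_top]
  refine h3.mono ?_
  have h4 := Submodule.map_span
    (UniformSpace.Completion.toComplL (𝕜 := ℂ) (E := SymTensorAlg E)).toLinearMap
    (Set.range (veeMonomial E e))
  rw [← Set.range_comp] at h4
  exact (congrArg (fun V : Submodule ℂ (FockSpace E) => (V : Set (FockSpace E))) h4).le

end Monomial

section ComplexGaussian

open scoped Real

/-! ### The circular Gaussian measure on `ℂ` -/

/-- The centred circular Gaussian measure on `ℂ` with `∫ ‖z‖² = b⁻¹`. -/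
def circularGaussian (b : ℝ) : Measure ℂ :=
  volume.withDensity fun z => ENNReal.ofReal (b / π * Real.exp (-b * ‖z‖ ^ 2))

theorem integral_circularGaussian {b : ℝ} (hb : 0 < b) (f : ℂ → ℂ) :
    ∫ z, f z ∂circularGaussian b =
      (b / π : ℝ) * ∫ z : ℂ, (Real.exp (-b * ‖z‖ ^ 2) : ℂ) * f z := by
  rw [circularGaussian, integral_withDensity_eq_integral_toReal_smul (by fun_prop)
    (Filter.Eventually.of_forall fun _ => ENNReal.ofReal_lt_top), ← integral_const_mul]
  refine integral_congr_ae (Filter.Eventually.of_forall fun z => ?_)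
  simp only
  rw [ENNReal.toReal_ofReal (by positivity), Complex.real_smul]
  push_cast
  ring

/-- The Gaussian Fourier integral on `ℂ` as a real plane; real dimension two makes `b / π` the
normalising constant. -/
theorem charFun_circularGaussian {b : ℝ} (hb : 0 < b) (t : ℂ) :
    charFun (circularGaussian b) t = Complex.exp (-(1 / 4 : ℂ) * ((b⁻¹ * ‖t‖ ^ 2 : ℝ) : ℂ)) := by
  have hπ : (π : ℂ) ≠ 0 := by exact_mod_cast Real.pi_ne_zero
  have hb' : (b : ℂ) ≠ 0 := by exact_mod_cast hb.ne'
  rw [charFun_apply, integral_circularGaussian hb]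
  have h := GaussianFourier.integral_cexp_neg_mul_sq_norm_add (V := ℂ) (b := (b : ℂ))
    (by simpa using hb) Complex.I t
  have h2 : ∀ z : ℂ, (Real.exp (-b * ‖z‖ ^ 2) : ℂ) * Complex.exp (inner ℝ z t * Complex.I) =
      Complex.exp (-b * ‖z‖ ^ 2 + Complex.I * inner ℝ t z) := by
    intro z
    rw [Complex.ofReal_exp, ← Complex.exp_add, real_inner_comm]
    push_cast
    ring_nf
  simp_rw [h2, h, Complex.finrank_real_complex]
  norm_num
  rw [← mul_assoc, div_mul_div_comm, mul_comm (b : ℂ), div_self (mul_ne_zero hπ hb'), one_mul]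
  congr 1
  field_simp

theorem integrable_exp_neg_mul_sq_norm {b : ℝ} (hb : 0 < b) :
    Integrable fun z : ℂ => Real.exp (-b * ‖z‖ ^ 2) := by
  have h := GaussianFourier.integrable_cexp_neg_mul_sq_norm_add (V := ℂ) (b := (b : ℂ))
    (by simpa using hb) 0 0
  refine h.norm.congr (Filter.Eventually.of_forall fun z => ?_)
  simp only [Complex.norm_exp]
  congr 1
  simp [← Complex.ofReal_pow]

theorem isFiniteMeasure_circularGaussian {b : ℝ} (hb : 0 < b) :
    IsFiniteMeasure (circularGaussian b) :=
  isFiniteMeasure_withDensity_ofReal ((integrable_exp_neg_mul_sq_norm hb).const_mul _).2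

theorem moment_circularGaussian_ne {b : ℝ} (hb : 0 < b) {m n : ℕ} (hmn : m ≠ n) :
    ∫ z, starRingEnd ℂ z ^ m * z ^ n ∂circularGaussian b = 0 := by
  rw [integral_circularGaussian hb]
  set F : ℂ → ℂ := fun z => (Real.exp (-b * ‖z‖ ^ 2) : ℂ) * (starRingEnd ℂ z ^ m * z ^ n) with hF
  have hd : ((n : ℂ) - m) ≠ 0 := sub_ne_zero.2 (by exact_mod_cast hmn.symm)
  -- This rotation multiplies the integrand by `e^{iπ} = -1` and preserves Lebesgue measure, so the
  -- integral equals its own negative.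
  let u : Circle := Circle.exp (π / ((n : ℝ) - m))
  have hu : starRingEnd ℂ (u : ℂ) ^ m * (u : ℂ) ^ n = -1 := by
    rw [Circle.coe_exp, ← Complex.exp_conj, ← Complex.exp_nat_mul, ← Complex.exp_nat_mul,
      ← Complex.exp_add, ← Complex.exp_pi_mul_I]
    congr 1
    simp only [map_mul, Complex.conj_ofReal, Complex.conj_I]
    push_cast
    field_simp
    ring
  have h1 := (rotation u).measurePreserving.integral_comp
    (rotation u).toHomeomorph.measurableEmbedding F
  have h2 : ∀ z, F (rotation u z) = -F z := by
    intro z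
    simp only [hF, rotation_apply, norm_mul, Circle.norm_coe, one_mul, map_mul, mul_pow]
    linear_combination (Real.exp (-b * ‖z‖ ^ 2) : ℂ) * (starRingEnd ℂ z ^ m * z ^ n) * hu
  simp_rw [h2, integral_neg] at h1
  rw [show ∫ z, F z = 0 by linear_combination (-1 / 2 : ℂ) * h1, mul_zero]

theorem moment_circularGaussian_self {b : ℝ} (hb : 0 < b) (n : ℕ) :
    ∫ z, starRingEnd ℂ z ^ n * z ^ n ∂circularGaussian b =
      ((n.factorial * b⁻¹ ^ n : ℝ) : ℂ) := by
  rw [integral_circularGaussian hb]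
  have h1 : ∀ z : ℂ, (Real.exp (-b * ‖z‖ ^ 2) : ℂ) * (starRingEnd ℂ z ^ n * z ^ n) =
      ((‖z‖ ^ ((2 * n : ℕ) : ℝ) * Real.exp (-b * ‖z‖ ^ (2 : ℝ)) : ℝ) : ℂ) := by
    intro z
    rw [← mul_pow, Complex.conj_mul', Real.rpow_natCast, Real.rpow_two, pow_mul]
    push_cast
    ring
  simp_rw [h1]
  rw [integral_complex_ofReal, Complex.integral_rpow_mul_exp_neg_mul_rpow (by norm_num)
    (by have : (0 : ℝ) ≤ ((2 * n : ℕ) : ℝ) := Nat.cast_nonneg _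
        linarith) hb, ← Complex.ofReal_mul]
  congr 1
  have h2 : (((2 * n : ℕ) : ℝ) + 2) / 2 = n + 1 := by push_cast; ring
  have h3 : -(((2 * n : ℕ) : ℝ) + 2) / 2 = -((n + 1 : ℕ) : ℝ) := by push_cast; ring
  rw [h2, h3, Real.Gamma_nat_eq_factorial, Real.rpow_neg hb.le, Real.rpow_natCast]
  have := Real.pi_ne_zero
  field_simp
  rw [one_div, inv_pow, pow_succ]
  field_simp

end ComplexGaussian

section Gauss

variable {H : Type*} [NormedAddCommGroup H] [InnerProductSpace ℂ H]

/-! ### The coordinates are independent circular Gaussians -/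

/-- Translates the real pairing on `ℂ` used by `charFun` into the real-part pairing of
`HasCovarianceOperator`. -/
theorem inner_real_coord (ξ : H) (t : ℂ) (x : H) :
    inner ℝ (inner ℂ ξ x : ℂ) t = RCLike.re (inner ℂ (t • ξ) x) := by
  rw [inner_smul_left, real_inner_comm, Complex.inner, mul_comm]
  rfl

variable {K : H →L[ℂ] H} [MeasurableSpace H] {μ : Measure H}

/-- Evaluating the covariance hypothesis at `∑ tⱼ ξⱼ`, where `K` is diagonal, splits the exponent.
This yields both the law of one coordinate and the independence of finitely many. -/
theorem integral_exp_coords {ξ : HilbertBasis ℕ ℂ H} {k : ℕ → ℝ}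
    (hξ : ∀ j, K (ξ j) = ((k j : ℂ) ^ 2) • ξ j) (hμ : HasCovarianceOperator μ K)
    (s : Finset ℕ) (t : s → ℂ) :
    ∫ x, Complex.exp ((∑ j : s, inner ℝ (inner ℂ (ξ j) x : ℂ) (t j) : ℝ) * Complex.I) ∂μ =
      ∏ j : s, Complex.exp (-(1 / 4 : ℂ) * ((k j ^ 2 * ‖t j‖ ^ 2 : ℝ) : ℂ)) := by
  have h := hμ (∑ j : s, t j • ξ j)
  have ho : Orthonormal ℂ fun j : s => ξ j := ξ.orthonormal.comp _ Subtype.val_injective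
  have h1 : K (∑ j : s, t j • ξ j) = ∑ j : s, (t j * (k j : ℂ) ^ 2) • ξ j := by
    simp only [map_sum, map_smul, hξ, smul_smul]
  rw [h1, ho.inner_sum] at h
  rw [← Complex.exp_sum, ← Finset.mul_sum]
  convert h using 2
  · funext x
    rw [mul_comm]
    congr 3
    simp only [sum_inner, map_sum, inner_real_coord]
  · congr 1
    push_cast
    refine Finset.sum_congr rfl fun j _ => ?_
    rw [← Complex.conj_mul']
    ring

variable [BorelSpace H] [SeparableSpace H]

theorem measurable_coord (ξ : H) : Measurable fun x : H => (inner ℂ ξ x : ℂ) := by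
  fun_prop

theorem charFun_coord {ξ : HilbertBasis ℕ ℂ H} {k : ℕ → ℝ}
    (hξ : ∀ j, K (ξ j) = ((k j : ℂ) ^ 2) • ξ j) (hμ : HasCovarianceOperator μ K)
    (j : ℕ) (t : ℂ) :
    charFun (μ.map fun x => (inner ℂ (ξ j) x : ℂ)) t =
      Complex.exp (-(1 / 4 : ℂ) * ((k j ^ 2 * ‖t‖ ^ 2 : ℝ) : ℂ)) := by
  rw [charFun_apply, integral_map (measurable_coord _).aemeasurable (by fun_prop)]
  simpa using integral_exp_coords hξ hμ {j} fun _ => t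

variable [IsGaussian μ]

theorem map_coord {ξ : HilbertBasis ℕ ℂ H} {k : ℕ → ℝ} (hk : ∀ j, 0 < k j)
    (hξ : ∀ j, K (ξ j) = ((k j : ℂ) ^ 2) • ξ j) (hμ : HasCovarianceOperator μ K) (j : ℕ) :
    μ.map (fun x => (inner ℂ (ξ j) x : ℂ)) = circularGaussian (k j ^ 2)⁻¹ := by
  have hb : 0 < (k j ^ 2)⁻¹ := by have := hk j; positivity
  have := isFiniteMeasure_circularGaussian hb
  refine Measure.ext_of_charFun (funext fun t => ?_)
  rw [charFun_coord hξ hμ, charFun_circularGaussian hb, inv_inv]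

theorem iIndepFun_coords {ξ : HilbertBasis ℕ ℂ H} {k : ℕ → ℝ}
    (hξ : ∀ j, K (ξ j) = ((k j : ℂ) ^ 2) • ξ j) (hμ : HasCovarianceOperator μ K)
    (s : Finset ℕ) :
    iIndepFun (fun (j : s) (x : H) => (inner ℂ (ξ j) x : ℂ)) μ := by
  have hm : ∀ j : s, Measurable fun x : H => (inner ℂ (ξ j) x : ℂ) := fun j => measurable_coord _
  rw [iIndepFun_iff_charFun_pi fun j => (hm j).aemeasurable]
  intro t
  rw [charFun_apply, integral_map (by fun_prop) (by fun_prop)]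
  simp_rw [charFun_coord hξ hμ]
  rw [← integral_exp_coords hξ hμ s t]
  simp only [PiLp.inner_apply]

/-! ### Inner products of monomials -/

theorem moment_coord {ξ : HilbertBasis ℕ ℂ H} {k : ℕ → ℝ} (hk : ∀ j, 0 < k j)
    (hξ : ∀ j, K (ξ j) = ((k j : ℂ) ^ 2) • ξ j) (hμ : HasCovarianceOperator μ K) (j m n : ℕ) :
    ∫ x, starRingEnd ℂ (inner ℂ (ξ j) x) ^ m * (inner ℂ (ξ j) x) ^ n ∂μ =
      if m = n then ((n.factorial * (k j ^ 2) ^ n : ℝ) : ℂ) else 0 := by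
  have hb : 0 < (k j ^ 2)⁻¹ := by have := hk j; positivity
  have h := integral_map (μ := μ) (φ := fun x => (inner ℂ (ξ j) x : ℂ))
    (f := fun z : ℂ => starRingEnd ℂ z ^ m * z ^ n) (measurable_coord _).aemeasurable
    (by fun_prop)
  rw [← h, map_coord hk hξ hμ]
  split_ifs with hmn
  · subst hmn
    rw [moment_circularGaussian_self hb, inv_inv]
  · exact moment_circularGaussian_ne hb hmn

variable [CompleteSpace H]

/-- Over the union of the supports both monomials are products on one index set, so independence
factors the integral into one-coordinate moments. -/
theorem inner_monomialLp_eq_prod {ξ : HilbertBasis ℕ ℂ H} {k : ℕ → ℝ} (hk : ∀ j, 0 < k j)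
    (hξ : ∀ j, K (ξ j) = ((k j : ℂ) ^ 2) • ξ j) (hμ : HasCovarianceOperator μ K)
    (I J : ℕ →₀ ℕ) :
    inner ℂ (monomialLp μ ξ I) (monomialLp μ ξ J) =
      ∏ j : ↥(I.support ∪ J.support), if I j = J j then
        (((J j).factorial * (k j ^ 2) ^ J j : ℝ) : ℂ) else 0 := by
  have hm : ∀ j : ↥(I.support ∪ J.support), Measurable fun x : H => (inner ℂ (ξ j) x : ℂ) :=
    fun j => measurable_coord _
  have h := (iIndepFun_coords hξ hμ (I.support ∪ J.support)).integral_fun_prod_comp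
    (f := fun (j : ↥(I.support ∪ J.support)) z => starRingEnd ℂ z ^ I j * z ^ J j) (fun j => (hm j).aemeasurable)
    (fun j => by fun_prop)
  simp_rw [moment_coord hk hξ hμ] at h
  rw [← h, L2.inner_def]
  refine integral_congr_ae ?_
  filter_upwards [(memLp_monomialFun μ ξ I).coeFn_toLp, (memLp_monomialFun μ ξ J).coeFn_toLp]
    with x hI hJ
  rw [monomialLp, monomialLp, hI, hJ, RCLike.inner_apply', monomialFun, monomialFun,
    Finsupp.prod_of_support_subset I Finset.subset_union_left _ (fun _ _ => pow_zero _),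
    Finsupp.prod_of_support_subset J Finset.subset_union_right _ (fun _ _ => pow_zero _),
    map_prod, ← Finset.prod_mul_distrib, ← Finset.prod_coe_sort]
  simp only [map_pow]

theorem inner_monomialLp_ne {ξ : HilbertBasis ℕ ℂ H} {k : ℕ → ℝ} (hk : ∀ j, 0 < k j)
    (hξ : ∀ j, K (ξ j) = ((k j : ℂ) ^ 2) • ξ j) (hμ : HasCovarianceOperator μ K)
    {I J : ℕ →₀ ℕ} (h : I ≠ J) :
    inner ℂ (monomialLp μ ξ I) (monomialLp μ ξ J) = 0 := by
  rw [inner_monomialLp_eq_prod hk hξ hμ]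
  obtain ⟨j, hj⟩ := DFunLike.ne_iff.1 h
  have hmem : j ∈ I.support ∪ J.support := by
    rw [Finset.mem_union, Finsupp.mem_support_iff, Finsupp.mem_support_iff]
    by_contra! h0
    exact hj (h0.1.trans h0.2.symm)
  exact Finset.prod_eq_zero (Finset.mem_univ ⟨j, hmem⟩) (if_neg hj)

theorem inner_monomialLp_self {ξ : HilbertBasis ℕ ℂ H} {k : ℕ → ℝ} (hk : ∀ j, 0 < k j)
    (hξ : ∀ j, K (ξ j) = ((k j : ℂ) ^ 2) • ξ j) (hμ : HasCovarianceOperator μ K)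
    (I : ℕ →₀ ℕ) :
    inner ℂ (monomialLp μ ξ I) (monomialLp μ ξ I) = (monomialNormSq k I : ℂ) := by
  rw [inner_monomialLp_eq_prod hk hξ hμ]
  simp only [if_true]
  rw [Finset.prod_coe_sort (I.support ∪ I.support)
    fun j => (((I j).factorial * (k j ^ 2) ^ I j : ℝ) : ℂ), Finset.union_idempotent,
    monomialNormSq, Finsupp.prod]
  push_cast
  rfl

end Gauss

section Hilbert

/-! ### Isometries from orthogonal families -/

variable {F G ι : Type*} [NormedAddCommGroup F] [InnerProductSpace ℂ F]
  [NormedAddCommGroup G] [InnerProductSpace ℂ G]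

theorem orthonormal_inv_sqrt_smul {v : ι → F} {c : ι → ℝ} (hc : ∀ i, 0 < c i)
    (h0 : ∀ i j, i ≠ j → inner ℂ (v i) (v j) = 0) (h1 : ∀ i, inner ℂ (v i) (v i) = (c i : ℂ)) :
    Orthonormal ℂ fun i => ((√(c i))⁻¹ : ℂ) • v i := by
  constructor
  · intro i
    have hn : ‖v i‖ = √(c i) := by
      rw [norm_eq_sqrt_re_inner (𝕜 := ℂ), h1]
      simp
    have hpos : √(c i) ≠ 0 := (Real.sqrt_pos.2 (hc i)).ne'
    rw [norm_smul, hn, norm_inv, Complex.norm_real, Real.norm_of_nonneg (Real.sqrt_nonneg _),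
      inv_mul_cancel₀ hpos]
  · intro i j hij
    simp [inner_smul_left, inner_smul_right, h0 i j hij]

theorem exists_isometryEquiv_of_orthogonal [CompleteSpace F] [CompleteSpace G] {v : ι → F}
    {w : ι → G} {c : ι → ℝ} (hc : ∀ i, 0 < c i)
    (hv0 : ∀ i j, i ≠ j → inner ℂ (v i) (v j) = 0) (hv1 : ∀ i, inner ℂ (v i) (v i) = (c i : ℂ))
    (hw0 : ∀ i j, i ≠ j → inner ℂ (w i) (w j) = 0) (hw1 : ∀ i, inner ℂ (w i) (w i) = (c i : ℂ))
    (hv : ⊤ ≤ (Submodule.span ℂ (Set.range v)).topologicalClosure)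
    (S : Submodule ℂ G) (hS : ∀ f, f ∈ S ↔ ∃ a : ι → ℂ, HasSum (fun i => a i • w i) f) :
    ∃ θ : F ≃ₗᵢ[ℂ] S, ∀ i, (θ (v i) : G) = w i := by
  classical
  have hne : ∀ i, (√(c i) : ℂ) ≠ 0 := fun i => by
    exact_mod_cast (Real.sqrt_pos.2 (hc i)).ne'
  have hvo := orthonormal_inv_sqrt_smul hc hv0 hv1
  have hwo := orthonormal_inv_sqrt_smul hc hw0 hw1
  have hdense : ⊤ ≤ (Submodule.span ℂ
      (Set.range fun i => ((√(c i))⁻¹ : ℂ) • v i)).topologicalClosure := by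
    refine hv.trans (Submodule.topologicalClosure_mono (Submodule.span_le.2 ?_))
    rintro _ ⟨i, rfl⟩
    have := Submodule.smul_mem _ (√(c i) : ℂ)
      (Submodule.subset_span (R := ℂ) (Set.mem_range_self (f := fun i => ((√(c i))⁻¹ : ℂ) • v i) i))
    rwa [smul_smul, mul_inv_cancel₀ (hne i), one_smul] at this
  let B := HilbertBasis.mk hvo hdense
  have hB : ∀ i, B i = ((√(c i))⁻¹ : ℂ) • v i :=
    fun i => congrFun (HilbertBasis.coe_mk hvo hdense) i
  let T : F →ₗᵢ[ℂ] G := hwo.orthogonalFamily.linearIsometry.comp B.repr.toLinearIsometry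
  have hTB : ∀ i, T (B i) = ((√(c i))⁻¹ : ℂ) • w i := by
    intro i
    change hwo.orthogonalFamily.linearIsometry (B.repr (B i)) = _
    rw [B.repr_self, OrthogonalFamily.linearIsometry_apply_single]
    simp
  have hT : ∀ i, T (v i) = w i := by
    intro i
    have h := hTB i
    rw [hB, map_smul] at h
    exact smul_right_injective G (inv_ne_zero (hne i)) h
  have hrange : LinearMap.range T.toLinearMap = S := by
    ext f
    constructor
    · rintro ⟨x, rfl⟩
      -- The coefficients in the normalised basis, divided by `√(c i)` to refer to the unnormalised
      -- `w i`.
      refine (hS _).2 ⟨fun i => B.repr x i * (√(c i) : ℂ)⁻¹, ?_⟩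
      have h := (B.hasSum_repr x).mapL T.toContinuousLinearMap
      simp only [LinearIsometry.coe_toContinuousLinearMap, map_smul, hTB, smul_smul] at h
      exact h
    · intro hf
      obtain ⟨a, ha⟩ := (hS f).1 hf
      -- `F` is complete, so the isometric image is closed and contains the limit of the partial
      -- sums.
      have hcl : IsClosed (Set.range T) := T.isometry.isClosedEmbedding.isClosed_range
      refine hcl.mem_of_tendsto ha (Filter.Eventually.of_forall fun s => ?_)
      refine ⟨∑ i ∈ s, a i • v i, ?_⟩
      simp [map_sum, hT]
  exact ⟨T.equivRange.trans (LinearIsometryEquiv.ofEq _ _ hrange), hT⟩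

end Hilbert

section CameronMartin

variable {H : Type*} [NormedAddCommGroup H] [InnerProductSpace ℂ H] [CompleteSpace H]
  {K : H →L[ℂ] H} (hK : IsPosDefTraceClass K)

/-! ### The dual of the Cameron–Martin space -/

/-- The Riesz vector is `K η`, written as `K^{1/2}` applied to `K^{1/2} η`; the reason is that
`K^{1/2}` is self-adjoint. -/
theorem toDual_symm_toCMDual (η : H) :
    (InnerProductSpace.toDual ℂ (CameronMartin hK)).symm (toCMDual hK η) =
      (invSqrt hK).symm (sqrtOp K η) := by
  rw [LinearIsometryEquiv.symm_apply_eq]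
  ext x
  have hsa : (sqrtOp K).IsPositive :=
    (ContinuousLinearMap.nonneg_iff_isPositive _).1 (CFC.sqrt_nonneg K)
  rw [toCMDual_apply, InnerProductSpace.toDual_apply_apply, cm_inner, LinearEquiv.apply_symm_apply,
    ← sqrtOp_invSqrt]
  exact (hsa.isSymmetric η (invSqrt hK x)).symm

theorem inner_toCMDual (η ζ : H) :
    inner ℂ (toCMDual hK η) (toCMDual hK ζ) = inner ℂ (K ζ) η := by
  have h0 : (0 : H →L[ℂ] H) ≤ K := (ContinuousLinearMap.nonneg_iff_isPositive K).2 hK.isPositive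
  have hsa : (sqrtOp K).IsPositive :=
    (ContinuousLinearMap.nonneg_iff_isPositive _).1 (CFC.sqrt_nonneg K)
  have hs : sqrtOp K * sqrtOp K = K := CFC.sqrt_mul_sqrt_self K h0
  change inner ℂ ((InnerProductSpace.toDual ℂ (CameronMartin hK)).symm (toCMDual hK ζ))
    ((InnerProductSpace.toDual ℂ (CameronMartin hK)).symm (toCMDual hK η)) = _
  rw [toDual_symm_toCMDual, toDual_symm_toCMDual, cm_inner, LinearEquiv.apply_symm_apply,
    LinearEquiv.apply_symm_apply]
  conv_rhs => rw [← hs]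
  exact (hsa.isSymmetric (sqrtOp K ζ) η).symm

theorem inner_toCMDual_eigenbasis {ξ : HilbertBasis ℕ ℂ H} {k : ℕ → ℝ}
    (hξ : ∀ j, K (ξ j) = ((k j : ℂ) ^ 2) • ξ j) (i j : ℕ) :
    inner ℂ (toCMDual hK (ξ i)) (toCMDual hK (ξ j)) =
      if i = j then ((k i ^ 2 : ℝ) : ℂ) else 0 := by
  rw [inner_toCMDual, hξ, inner_smul_left, orthonormal_iff_ite.1 ξ.orthonormal]
  split_ifs with h1 h2 h2
  · subst h1; simp
  · exact absurd h1.symm h2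
  · exact absurd h2.symm h1
  · simp

/-- The Riesz vector of a functional orthogonal to the span has all `ξⱼ`-coordinates zero in `H`,
and `H_μ` injects into `H`. -/
theorem span_toCMDual_dense (ξ : HilbertBasis ℕ ℂ H) :
    (Submodule.span ℂ (Set.range fun j => toCMDual hK (ξ j))).topologicalClosure = ⊤ := by
  refine (Submodule.topologicalClosure_eq_top_iff (𝕜 := ℂ) (E := CameronMartinDual hK)
    (K := Submodule.span ℂ (Set.range fun j => toCMDual hK (ξ j)))).2 ?_
  rw [Submodule.eq_bot_iff]
  intro g hg
  set x := (InnerProductSpace.toDual ℂ (CameronMartin hK)).symm g with hx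
  have hj : ∀ j, inner ℂ (ξ j) (cmIncl hK x) = 0 := by
    intro j
    have h := (Submodule.mem_orthogonal _ _).1 hg _ (Submodule.subset_span ⟨j, rfl⟩)
    rw [← toCMDual_apply]
    have h2 : toCMDual hK (ξ j) = InnerProductSpace.toDual ℂ (CameronMartin hK)
      ((InnerProductSpace.toDual ℂ (CameronMartin hK)).symm (toCMDual hK (ξ j))) := by simp
    rw [h2, InnerProductSpace.toDual_apply_apply, ← inner_conj_symm]
    exact (congrArg _ h).trans (map_zero _)
  have h0 : cmIncl hK x = 0 := by
    apply ξ.repr.injective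
    ext j
    rw [ξ.repr_apply_apply, hj]
    simp
  have hx0 : x = 0 := Subtype.ext h0
  rw [hx] at hx0
  simpa using hx0

end CameronMartin

section Multiplicative

/-! ### Multiplicativity -/

theorem append_update_left {α : Type*} {n m : ℕ} (x : Fin n → α) (y : Fin m → α) (i : Fin n)
    (a : α) :
    Fin.append (Function.update x i a) y = Function.update (Fin.append x y) (Fin.castAdd m i) a := by
  funext r
  refine Fin.addCases (fun r => ?_) (fun r => ?_) r
  · simp [Function.update_apply]
  · rw [Fin.append_right, Function.update_of_ne (by simp [Fin.ext_iff]; omega), Fin.append_right]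

theorem append_update_right {α : Type*} {n m : ℕ} (x : Fin n → α) (y : Fin m → α) (i : Fin m)
    (a : α) :
    Fin.append x (Function.update y i a) = Function.update (Fin.append x y) (Fin.natAdd n i) a := by
  funext r
  refine Fin.addCases (fun r => ?_) (fun r => ?_) r
  · rw [Fin.append_left, Function.update_of_ne (by simp [Fin.ext_iff]; omega), Fin.append_left]
  · simp [Function.update_apply]

variable {H : Type*} [MeasurableSpace H] {μ : Measure H}

/-- Pointwise multiplication `L² × L² → L¹`. -/
def mulLp (μ : Measure H) : Lp ℂ 2 μ →L[ℂ] Lp ℂ 2 μ →L[ℂ] Lp ℂ 1 μ :=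
  (ContinuousLinearMap.mul ℂ ℂ).holderL μ 2 2 1

theorem coeFn_mulLp (f g : Lp ℂ 2 μ) : mulLp μ f g =ᵐ[μ] fun x => f x * g x :=
  (ContinuousLinearMap.mul ℂ ℂ).coeFn_holder f g

/-- The inclusion `L² → L¹`. -/
def inclLp (μ : Measure H) [IsFiniteMeasure μ] : Lp ℂ 2 μ →L[ℂ] Lp ℂ 1 μ := (mulLp μ).flip (Lp.const 2 μ (1 : ℂ))

theorem coeFn_inclLp [IsFiniteMeasure μ] (f : Lp ℂ 2 μ) : inclLp μ f =ᵐ[μ] f := by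
  have h : inclLp μ f = mulLp μ f (Lp.const 2 μ (1 : ℂ)) := rfl
  rw [h]
  filter_upwards [coeFn_mulLp f (Lp.const 2 μ (1 : ℂ)), Lp.coeFn_const 2 μ (1 : ℂ)] with x h1 h2
  rw [h1, h2]
  simp

variable [NormedAddCommGroup H] [InnerProductSpace ℂ H] [CompleteSpace H]
  [SeparableSpace H] [BorelSpace H] [IsGaussian μ]
  {E : Type*} [NormedAddCommGroup E] [InnerProductSpace ℂ E]

theorem coeFn_monomialLp_tupleIndex (ξ : HilbertBasis ℕ ℂ H) {n : ℕ} (f : Fin n → ℕ) :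
    monomialLp μ ξ (tupleIndex f) =ᵐ[μ] fun x => ∏ r, inner ℂ (ξ (f r)) x := by
  refine (memLp_monomialFun μ ξ _).coeFn_toLp.trans (Filter.Eventually.of_forall fun x => ?_)
  rw [monomialFun]
  exact (prod_comp_tuple f _ (toMultiset_tupleIndex f).symm fun a => inner ℂ (ξ a) x).symm

variable {ξ : HilbertBasis ℕ ℂ H} {e : ℕ → E} {Θ : SymTensorAlg E →L[ℂ] Lp ℂ 2 μ}

/-- Two nested slot-by-slot inductions, first freeing the entries of `x`, then those of `y`. For
basis vectors both sides are the same product of coordinate functions. -/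
theorem inclLp_veeProd_append
    (he : (Submodule.span ℂ (Set.range e)).topologicalClosure = ⊤)
    (hΘ : ∀ I, Θ (veeMonomial E e I) = monomialLp μ ξ I) {n m : ℕ} (x : Fin n → E)
    (y : Fin m → E) :
    inclLp μ (Θ (veeProd E (Fin.append x y))) = mulLp μ (Θ (veeProd E x)) (Θ (veeProd E y)) := by
  revert y
  refine tuple_induction he (P := fun x => ∀ y : Fin m → E,
    inclLp μ (Θ (veeProd E (Fin.append x y))) = mulLp μ (Θ (veeProd E x)) (Θ (veeProd E y))) (fun f => ?_) (fun x i => ?_) x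
  · refine tuple_induction he (fun g => ?_) (fun y i => ?_)
    · have happ : Fin.append (e ∘ f) (e ∘ g) = e ∘ Fin.append f g := by
        funext r
        refine Fin.addCases (fun r => ?_) (fun r => ?_) r <;> simp
      rw [happ, veeProd_comp, veeProd_comp, veeProd_comp, hΘ, hΘ, hΘ]
      apply Lp.ext
      filter_upwards [coeFn_inclLp (monomialLp μ ξ (tupleIndex (Fin.append f g))),
        coeFn_mulLp (monomialLp μ ξ (tupleIndex f)) (monomialLp μ ξ (tupleIndex g)),
        coeFn_monomialLp_tupleIndex (μ := μ) ξ (Fin.append f g),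
        coeFn_monomialLp_tupleIndex (μ := μ) ξ f,
        coeFn_monomialLp_tupleIndex (μ := μ) ξ g] with x h1 h2 h3 h4 h5
      rw [h1, h2, h3, h4, h5, Fin.prod_univ_add]
      simp
    · let L := inclLp μ ∘L Θ ∘L (veeProdL (n + m)).toContinuousLinearMap
          (Fin.append (e ∘ f) y) (Fin.natAdd n i) -
        (mulLp μ (Θ (veeProd E (e ∘ f)))) ∘L Θ ∘L (veeProdL m).toContinuousLinearMap y i
      refine ⟨LinearMap.ker L.toLinearMap, L.isClosed_ker, fun η => ?_⟩
      rw [LinearMap.mem_ker]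
      change inclLp μ (Θ (veeProd E (Function.update (Fin.append (e ∘ f) y) (Fin.natAdd n i) η))) -
        mulLp μ (Θ (veeProd E (e ∘ f))) (Θ (veeProd E (Function.update y i η))) = 0 ↔ _
      rw [sub_eq_zero, append_update_right]
  · let L := fun y : Fin m → E => inclLp μ ∘L Θ ∘L (veeProdL (n + m)).toContinuousLinearMap
          (Fin.append x y) (Fin.castAdd m i) -
        ((mulLp μ).flip (Θ (veeProd E y))) ∘L Θ ∘L (veeProdL n).toContinuousLinearMap x i
    -- The property quantifies over all `y`, so the closed subspace is an intersection of kernels.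
    refine ⟨⨅ y, LinearMap.ker (L y).toLinearMap, ?_, fun η => ?_⟩
    · rw [Submodule.coe_iInf]
      exact isClosed_iInter fun y => (L y).isClosed_ker
    rw [Submodule.mem_iInf]
    refine forall_congr' fun y => ?_
    rw [LinearMap.mem_ker]
    change inclLp μ (Θ (veeProd E (Function.update (Fin.append x y) (Fin.castAdd m i) η))) -
      mulLp μ (Θ (veeProd E (Function.update x i η))) (Θ (veeProd E y)) = 0 ↔ _
    rw [sub_eq_zero, append_update_left]

theorem inclLp_vee (he : (Submodule.span ℂ (Set.range e)).topologicalClosure = ⊤)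
    (hΘ : ∀ I, Θ (veeMonomial E e I) = monomialLp μ ξ I) (a b : SymTensorAlg E) :
    inclLp μ (Θ (vee E a b)) = mulLp μ (Θ a) (Θ b) := by
  have ha : a ∈ Submodule.span ℂ (⋃ n, Set.range fun x : Fin n → E => veeProd E x) := by
    rw [span_veeProd_eq_top]; trivial
  have hb : b ∈ Submodule.span ℂ (⋃ n, Set.range fun x : Fin n → E => veeProd E x) := by
    rw [span_veeProd_eq_top]; trivial
  induction ha using Submodule.span_induction with
  | zero => simp
  | add a₁ a₂ _ _ h₁ h₂ => simp only [map_add, add_apply, LinearMap.add_apply,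
      h₁, h₂]
  | smul c a _ h => simp only [map_smul, smul_apply, LinearMap.smul_apply, h]
  | mem a ha =>
    obtain ⟨n, x, rfl⟩ := Set.mem_iUnion.1 ha
    induction hb using Submodule.span_induction with
    | zero => simp
    | add b₁ b₂ _ _ h₁ h₂ => simp only [map_add, h₁, h₂]
    | smul c b _ h => simp only [map_smul, h]
    | mem b hb =>
      obtain ⟨m, y, rfl⟩ := Set.mem_iUnion.1 hb
      simp only [vee_veeProd]
      exact inclLp_veeProd_append he hΘ x y

theorem coeFn_vee (he : (Submodule.span ℂ (Set.range e)).topologicalClosure = ⊤)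
    (hΘ : ∀ I, Θ (veeMonomial E e I) = monomialLp μ ξ I) (a b : SymTensorAlg E) :
    Θ (vee E a b) =ᵐ[μ] fun x => Θ a x * Θ b x := by
  refine (coeFn_inclLp _).symm.trans ?_
  rw [inclLp_vee he hΘ]
  exact coeFn_mulLp _ _

end Multiplicative

end SegalFock

end
-- The isometric isomorphism and its properties
open SegalFock in
theorem mainTheorem2 {H : Type*} [NormedAddCommGroup H] [InnerProductSpace ℂ H] [CompleteSpace H]
    [SeparableSpace H] [MeasurableSpace H] [BorelSpace H]
    (K : H →L[ℂ] H) (hK : IsPosDefTraceClass K)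
    (ξ : HilbertBasis ℕ ℂ H) (k : ℕ → ℝ) (hk : ∀ j, 0 < k j)
    (hξ : ∀ j, K (ξ j) = ((k j : ℂ) ^ 2) • ξ j)
    (μ : Measure H) [IsGaussian μ] (hμ : HasCovarianceOperator μ K) :
    ∃ θ : FockSpace (CameronMartinDual hK) ≃ₗᵢ[ℂ] segalBargmann μ ξ,
      -- `θ` extends `ξ^{∨I} ↦ z^I`, and is the only bounded linear map that does
      (∀ I : ℕ →₀ ℕ,
        (θ (veeMonomial (CameronMartinDual hK) (fun j => toCMDual hK (ξ j)) I :
          FockSpace (CameronMartinDual hK)) : Lp ℂ 2 μ) = monomialLp μ ξ I) ∧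
      (∀ θ' : FockSpace (CameronMartinDual hK) →L[ℂ] segalBargmann μ ξ,
        (∀ I : ℕ →₀ ℕ,
          (θ' (veeMonomial (CameronMartinDual hK) (fun j => toCMDual hK (ξ j)) I :
            FockSpace (CameronMartinDual hK)) : Lp ℂ 2 μ) = monomialLp μ ξ I) →
        ∀ a, θ' a = θ a) ∧
      -- `θ (a ∨ b) = θ a · θ b` on the symmetric tensor algebra of `H_μ^*`
      (∀ a b : SymTensorAlg (CameronMartinDual hK),
        ((θ (vee (CameronMartinDual hK) a b : FockSpace (CameronMartinDual hK)) : Lp ℂ 2 μ) :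
            H → ℂ) =ᵐ[μ]
          fun x => ((θ (a : FockSpace (CameronMartinDual hK)) : Lp ℂ 2 μ) : H → ℂ) x *
            ((θ (b : FockSpace (CameronMartinDual hK)) : Lp ℂ 2 μ) : H → ℂ) x) ∧
      -- `θ` carries the finite linear combinations of the `ξ^{∨I}` onto the polynomials
      (fun a : SymTensorAlg (CameronMartinDual hK) =>
          (θ (a : FockSpace (CameronMartinDual hK)) : Lp ℂ 2 μ)) ''
        (Submodule.span ℂ (Set.range
          (veeMonomial (CameronMartinDual hK) (fun j => toCMDual hK (ξ j)))) : Set _) =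
        (polynomials μ ξ : Set (Lp ℂ 2 μ)) := by
  have he0 := inner_toCMDual_eigenbasis hK hξ
  have hdense := span_toCMDual_dense hK ξ
  have hspan := span_veeMonomial_coe_dense (E := CameronMartinDual hK)
    (e := fun j => toCMDual hK (ξ j)) hdense
  obtain ⟨θ, hθ⟩ := exists_isometryEquiv_of_orthogonal (monomialNormSq_pos hk)
    (v := fun I => (veeMonomial (CameronMartinDual hK) (fun j => toCMDual hK (ξ j)) I :
      FockSpace (CameronMartinDual hK)))
    (w := monomialLp μ ξ)
    (fun I J h => by
      rw [UniformSpace.Completion.inner_coe]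
      exact inner_veeMonomial_ne (fun i j hij => by rw [he0, if_neg hij]) h)
    (fun I => by
      rw [UniformSpace.Completion.inner_coe]
      exact inner_veeMonomial_self he0 I)
    (fun I J h => inner_monomialLp_ne hk hξ hμ h)
    (fun I => inner_monomialLp_self hk hξ hμ I)
    hspan (segalBargmann μ ξ) (fun f => Iff.rfl)
  -- `θ` restricted to the algebraic part and read in `L²`, the form needed for both
  -- multiplicativity and the image of the span.
  let Θ : SymTensorAlg (CameronMartinDual hK) →L[ℂ] Lp ℂ 2 μ :=
    (segalBargmann μ ξ).subtypeL ∘L (θ.toContinuousLinearEquiv :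
      FockSpace (CameronMartinDual hK) →L[ℂ] segalBargmann μ ξ) ∘L
      UniformSpace.Completion.toComplL
  refine ⟨θ, hθ, fun θ' hθ' a => ?_, fun a b => ?_, ?_⟩
  · have h : θ' = (θ.toContinuousLinearEquiv :
        FockSpace (CameronMartinDual hK) →L[ℂ] segalBargmann μ ξ) := by
      refine ContinuousLinearMap.ext_on
        (Submodule.dense_iff_topologicalClosure_eq_top.2 (top_le_iff.1 hspan)) ?_
      rintro _ ⟨I, rfl⟩
      exact Subtype.ext ((hθ' I).trans (hθ I).symm)
    exact congrArg (fun T => T a) h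
  · exact coeFn_vee (E := CameronMartinDual hK) (e := fun j => toCMDual hK (ξ j)) (Θ := Θ) hdense hθ a b
  · have h := Submodule.map_span Θ.toLinearMap (Set.range
      (veeMonomial (CameronMartinDual hK) (fun j => toCMDual hK (ξ j))))
    rw [← Set.range_comp, show Θ.toLinearMap ∘ veeMonomial (CameronMartinDual hK)
      (fun j => toCMDual hK (ξ j)) = monomialLp μ ξ from funext hθ] at h
    exact congrArg (fun V : Submodule ℂ (Lp ℂ 2 μ) => (V : Set (Lp ℂ 2 μ))) h
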